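/- **Associative minimum modulus principle.** Let $A$ be one of the real $*$-algebras $\mathbb{C},\mathbb{H},\mathbb{O}$, with conjugation $x\mapsto x^c$, Euclidean norm $|x|=\sqrt{xx^c}$, and sphere of imaginary units $\mathbb{S}=\{J\in A : J+J^c=0,\ JJ^c=1\}$. Let $D\subseteq\mathbb{C}$ be open and invariant under complex conjugation, and let $$\Omega=\Omega_D=\{\alpha+\beta J : \alpha,\beta\in\mathbb{R},\ J\in\mathbb{S},\ \alpha+i\beta\in D\}\subseteq A .$$ Call $\Omega$ a *slice domain* if $D$ is connected and meets $\mathbb{R}$, and a *product domain* if $D\cap\mathbb{R}=\emptyset$ and $D$ has exactly two connected components, switched by complex conjugation. A function $f:\Omega\to A$ is *slice regular* if $f(\alpha+\beta J)=F_1(\alpha+i\beta)+J\,F_2(\alpha+i\beta)$ for all $\alpha+i\beta\in D$ and $J\in\mathbb{S}$, where $F_1,F_2:D\to A$ are of class $C^1$ and satisfy $F_1(\bar z)=F_1(z)$, $F_2(\bar z)=-F_2(z)$, $\partial_\alpha F_1=\partial_\beta F_2$ and $\partial_\beta F_1=-\partial_\alpha F_2$. Its slice conjugate is $f^c(\alpha+\beta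 J)=F_1(\alpha+i\beta)^c+J\,F_2(\alpha+i\beta)^c$, and its spherical derivative is $$f'_s(x)=\tfrac12\,\mathrm{im}(x)^{-1}\bigl(f(x)-f(x^c)\bigr),\qquad x\in\Omega\setminus\mathbb{R},\quad \mathrm{im}(x)=\tfrac12(x-x^c).$$ Let $f:\Omega\to A$ be slice regular and assume that the associator $(x,f^c(x),f'_s(x))=\bigl(x\,f^c(x)\bigr)f'_s(x)-x\bigl(f^c(x)\,f'_s(x)\bigr)$ vanishes for all $x\in\Omega\setminus\mathbb{R}$. Suppose that $|f|$ has a local minimum point $x_0\in\Omega$ with $f(x_0)\neq0$. 1. If $\Omega$ is a slice domain, then $f$ is constant on $\Omega$. 2. If $\Omega$ is a product domain, then there exists $J\in\mathbb{S}$ such that $f(x)=f(x_0)$ for all $x$ in the half-slice $\Omega_J^+=\Omega\cap\{\alpha+\beta J : \alpha,\beta\in\mathbb{R},\ \beta>0\}$. -/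

import Mathlib

open Set Topology
open scoped Quaternion ComplexConjugate

noncomputable section

/-! ## The algebras `ℂ`, `ℍ`, `𝕆` -/

/-- The common structure of `ℂ`, `ℍ` and `𝕆`: a real unital alternative algebra with a
`*`-involution `star` (written `x ↦ xᶜ` in the mathematics), whose Euclidean norm satisfies
`n(x) = x xᶜ = ‖x‖²`. It only serves to state the definitions below uniformly; the three
algebras are constructed explicitly as instances. -/
class NormedStarAlternative (A : Type) extends
    NormedAddCommGroup A, NonAssocRing A, NormedSpace ℝ A, StarRing A where
  smul_mul' : ∀ (r : ℝ) (x y : A), (r • x) * y = r • (x * y)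
  mul_smul' : ∀ (r : ℝ) (x y : A), x * (r • y) = r • (x * y)
  star_smul' : ∀ (r : ℝ) (x : A), star (r • x) = r • star x
  left_alt : ∀ x y : A, (x * x) * y = x * (x * y)
  mul_star' : ∀ x : A, x * star x = (‖x‖ ^ 2) • (1 : A)

instance : NormedStarAlternative ℂ where
  __ := (inferInstance : NormedAddCommGroup ℂ)
  __ := (inferInstance : NonAssocRing ℂ)
  __ := (inferInstance : NormedSpace ℝ ℂ)
  __ := (inferInstance : StarRing ℂ)
  smul_mul' r x y := smul_mul_assoc r x y
  mul_smul' r x y := mul_smul_comm r x y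
  star_smul' r x := by simp
  left_alt x y := mul_assoc x x y
  mul_star' x := by
    change x * conj x = _
    rw [Complex.mul_conj, Complex.normSq_eq_norm_sq]; simp

instance : NormedStarAlternative ℍ[ℝ] where
  __ := (inferInstance : NormedAddCommGroup ℍ[ℝ])
  __ := (inferInstance : NonAssocRing ℍ[ℝ])
  __ := (inferInstance : NormedSpace ℝ ℍ[ℝ])
  __ := (inferInstance : StarRing ℍ[ℝ])
  smul_mul' r x y := smul_mul_assoc r x y
  mul_smul' r x y := mul_smul_comm r x y
  star_smul' r x := by simp
  left_alt x y := mul_assoc x x y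
  mul_star' x := by
    rw [Quaternion.self_mul_star, Quaternion.normSq_eq_norm_mul_self, ← sq,
      ← Quaternion.coe_mul_eq_smul, mul_one]

/-- The octonions `𝕆 = ℍ + ℓ ℍ`, with the Euclidean norm; `⟨a, b⟩` stands for `a + ℓ b`. -/
def Octonion : Type := WithLp 2 (ℍ[ℝ] × ℍ[ℝ])

namespace Octonion

instance : NormedAddCommGroup Octonion := inferInstanceAs (NormedAddCommGroup (WithLp 2 (ℍ[ℝ] × ℍ[ℝ])))

instance : NormedSpace ℝ Octonion := inferInstanceAs (NormedSpace ℝ (WithLp 2 (ℍ[ℝ] × ℍ[ℝ])))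

/-- The octonion `a + ℓ b`. -/
def mk (a b : ℍ[ℝ]) : Octonion := WithLp.toLp 2 (a, b)

/-- The component `a` of `a + ℓ b`. -/
def fst (x : Octonion) : ℍ[ℝ] := WithLp.fst x

/-- The component `b` of `a + ℓ b`. -/
def snd (x : Octonion) : ℍ[ℝ] := WithLp.snd x

/-- Cayley-Dickson product `(α + ℓβ)(γ + ℓδ) = αγ - δβᶜ + ℓ(αᶜδ + γβ)`. -/
instance : Mul Octonion where
  mul x y := mk (x.fst * y.fst - y.snd * star x.snd) (star x.fst * y.snd + y.fst * x.snd)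

instance : One Octonion := ⟨mk 1 0⟩

/-- Conjugation `(α + ℓβ)ᶜ = αᶜ - ℓβ`. -/
instance : Star Octonion := ⟨fun x => mk (star x.fst) (-x.snd)⟩

theorem ext {x y : Octonion} (h₁ : x.fst = y.fst) (h₂ : x.snd = y.snd) : x = y :=
  WithLp.ofLp_injective 2 (Prod.ext h₁ h₂)

@[simp] theorem fst_mk (a b : ℍ[ℝ]) : (mk a b).fst = a := rfl
@[simp] theorem snd_mk (a b : ℍ[ℝ]) : (mk a b).snd = b := rfl
@[simp] theorem fst_add (x y : Octonion) : (x + y).fst = x.fst + y.fst := rfl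
@[simp] theorem snd_add (x y : Octonion) : (x + y).snd = x.snd + y.snd := rfl
@[simp] theorem fst_zero : (0 : Octonion).fst = 0 := rfl
@[simp] theorem snd_zero : (0 : Octonion).snd = 0 := rfl
@[simp] theorem fst_smul (r : ℝ) (x : Octonion) : (r • x).fst = r • x.fst := rfl
@[simp] theorem snd_smul (r : ℝ) (x : Octonion) : (r • x).snd = r • x.snd := rfl
@[simp] theorem fst_one : (1 : Octonion).fst = 1 := rfl
@[simp] theorem snd_one : (1 : Octonion).snd = 0 := rfl
@[simp] theorem fst_star (x : Octonion) : (star x).fst = star x.fst := rfl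
@[simp] theorem snd_star (x : Octonion) : (star x).snd = -x.snd := rfl
@[simp] theorem fst_mul (x y : Octonion) :
    (x * y).fst = x.fst * y.fst - y.snd * star x.snd := rfl
@[simp] theorem snd_mul (x y : Octonion) :
    (x * y).snd = star x.fst * y.snd + y.fst * x.snd := rfl

theorem norm_sq (x : Octonion) : ‖x‖ ^ 2 = ‖x.fst‖ ^ 2 + ‖x.snd‖ ^ 2 :=
  WithLp.prod_norm_sq_eq_of_L2 (α := ℍ[ℝ]) (β := ℍ[ℝ]) x

instance : NonAssocRing Octonion where
  __ := (inferInstance : AddCommGroup Octonion)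
  left_distrib x y z := by
    apply ext <;> simp [mul_add, add_mul] <;> abel
  right_distrib x y z := by
    apply ext <;> simp [mul_add, add_mul] <;> abel
  zero_mul x := by apply ext <;> simp
  mul_zero x := by apply ext <;> simp
  one_mul x := by apply ext <;> simp
  mul_one x := by apply ext <;> simp

instance : StarRing Octonion where
  star_involutive x := by apply ext <;> simp
  star_mul x y := by
    apply ext <;> simp [add_comm]
  star_add x y := by apply ext <;> simp [add_comm]

instance : NormedStarAlternative Octonion where
  __ := (inferInstance : NormedAddCommGroup Octonion)
  __ := (inferInstance : NonAssocRing Octonion)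
  __ := (inferInstance : NormedSpace ℝ Octonion)
  __ := (inferInstance : StarRing Octonion)
  smul_mul' r x y := by apply ext <;> simp [smul_sub]
  mul_smul' r x y := by apply ext <;> simp [smul_sub]
  star_smul' r x := by apply ext <;> simp
  left_alt x y := by
    apply ext <;> ext <;> simp <;> ring
  mul_star' x := by
    apply ext
    · rw [norm_sq, fst_smul, fst_one, fst_mul, fst_star, snd_star, neg_mul, sub_neg_eq_add,
        Quaternion.self_mul_star, Quaternion.self_mul_star,
        Quaternion.normSq_eq_norm_mul_self, Quaternion.normSq_eq_norm_mul_self,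
        ← Quaternion.coe_mul_eq_smul, mul_one, ← Quaternion.coe_add, ← sq, ← sq]
    · simp

end Octonion

/-- Labels for the three algebras `ℂ`, `ℍ`, `𝕆`. -/
inductive HypercomplexKind
  | complex
  | quaternion
  | octonion

/-- The algebra `ℂ`, `ℍ` or `𝕆`. -/
def HypercomplexKind.Carrier : HypercomplexKind → Type
  | .complex => ℂ
  | .quaternion => ℍ[ℝ]
  | .octonion => Octonion

instance : (k : HypercomplexKind) → NormedStarAlternative k.Carrier
  | .complex => inferInstanceAs (NormedStarAlternative ℂ)
  | .quaternion => inferInstanceAs (NormedStarAlternative ℍ[ℝ])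
  | .octonion => inferInstanceAs (NormedStarAlternative Octonion)

/-! ## Imaginary units, slices, circular sets -/

namespace SliceAnalysis

section Algebra

variable (A : Type) [NormedStarAlternative A]

/-- The subset `ℝ = ℝ 1` of `A`. -/
def realLine : Set A := {x | ∃ r : ℝ, x = r • (1 : A)}

/-- The sphere `𝕊` of imaginary units: trace `0` and norm `1`. -/
def imaginaryUnits : Set A := {J | J + star J = 0 ∧ J * star J = 1}

variable {A}

/-- `φ_J(z) = α + β J` for `z = α + i β`. -/
def slicePoint (J : A) (z : ℂ) : A := z.re • (1 : A) + z.im • J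

/-- The open half-slice `ℂ_J⁺ = {α + β J : β > 0}`. -/
def halfSlice (J : A) : Set A := {x | ∃ z : ℂ, 0 < z.im ∧ x = slicePoint J z}

variable (A)

/-- The circularization `Ω_D ⊆ A` of `D ⊆ ℂ`. -/
def circularization (D : Set ℂ) : Set A :=
  {x | ∃ z ∈ D, ∃ J ∈ imaginaryUnits A, x = slicePoint J z}

variable {A}

/-- Imaginary part `(x - xᶜ)/2`. -/
def imPart (x : A) : A := (1 / 2 : ℝ) • (x - star x)

/-- Multiplicative inverse `n(x)⁻¹ xᶜ` (with value `0` at `0`). -/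
def hinv (x : A) : A := (‖x‖ ^ 2)⁻¹ • star x

/-- Spherical value `(f(x) + f(xᶜ))/2`. -/
def sphericalValue (f : A → A) (x : A) : A := (1 / 2 : ℝ) • (f x + f (star x))

/-- Spherical derivative `½ im(x)⁻¹ (f(x) - f(xᶜ))`; meaningful for `x ∉ ℝ`. -/
def sphericalDerivative (f : A → A) (x : A) : A :=
  (1 / 2 : ℝ) • (hinv (imPart x) * (f x - f (star x)))

/-- `F₁ + ι F₂ : D → A ⊗ ℂ` is a stem function: it intertwines the conjugations of `ℂ` and of
the complexification of `A`. -/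
structure IsStem (D : Set ℂ) (F₁ F₂ : ℂ → A) : Prop where
  even : ∀ z ∈ D, F₁ (conj z) = F₁ z
  odd : ∀ z ∈ D, F₂ (conj z) = -F₂ z

/-- `f` is the slice function on `Ω_D` induced by `F₁ + ι F₂`:
`f(α + β J) = F₁(α + i β) + J F₂(α + i β)`. -/
def Induces (D : Set ℂ) (F₁ F₂ : ℂ → A) (f : A → A) : Prop :=
  ∀ z ∈ D, ∀ J ∈ imaginaryUnits A, f (slicePoint J z) = F₁ z + J * F₂ z

/-- `f` is a slice regular function on `Ω_D` (`D` open): it is induced by a stem function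
`F₁ + ι F₂` of class `C¹` that is holomorphic, i.e. satisfies the Cauchy-Riemann equations
`∂F₁/∂α = ∂F₂/∂β`, `∂F₁/∂β = -∂F₂/∂α`. Only the values of `f` on `Ω_D` matter. -/
def IsSliceRegular (D : Set ℂ) (f : A → A) : Prop :=
  ∃ F₁ F₂ : ℂ → A, IsStem D F₁ F₂ ∧ Induces D F₁ F₂ f ∧
    ContDiffOn ℝ 1 F₁ D ∧ ContDiffOn ℝ 1 F₂ D ∧
    ∀ z ∈ D, fderiv ℝ F₁ z 1 = fderiv ℝ F₂ z Complex.I ∧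
      fderiv ℝ F₁ z Complex.I = -fderiv ℝ F₂ z 1

/-- Slice conjugate `fᶜ` of a slice function `f`: the slice function with spherical value
`v_s(f)ᶜ` and spherical derivative `(f'_s)ᶜ`. At a real point, `im(x) = 0` and this is `f(x)ᶜ`.
By `induces_sliceConj`, it is the slice function induced by `F₁ᶜ + ι F₂ᶜ`. -/
def sliceConj (f : A → A) (x : A) : A :=
  star (sphericalValue f x) + imPart x * star (sphericalDerivative f x)

end Algebra

/-! ## Slice domains and product domains -/

/-- `Ω_D` is a slice domain (for `D` invariant under conjugation): `D` is open, connected and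
meets `ℝ`. -/
def IsSliceDomain (D : Set ℂ) : Prop :=
  IsOpen D ∧ IsConnected D ∧ ∃ r : ℝ, (r : ℂ) ∈ D

/-- `Ω_D` is a product domain: `D` is open, does not meet `ℝ`, and has exactly two connected
components, switched by complex conjugation. -/
def IsProductDomain (D : Set ℂ) : Prop :=
  IsOpen D ∧ (∀ r : ℝ, (r : ℂ) ∉ D) ∧ ∃ z ∈ D, ∃ w ∈ D,
    connectedComponentIn D z ≠ connectedComponentIn D w ∧
    D = connectedComponentIn D z ∪ connectedComponentIn D w ∧
    conj '' connectedComponentIn D z = connectedComponentIn D w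

/-! ## The slice conjugate is induced by the conjugate stem function -/

section Facts

variable {A : Type} [NormedStarAlternative A]

theorem star_one_smul (r : ℝ) : star (r • (1 : A)) = r • (1 : A) := by
  rw [NormedStarAlternative.star_smul', star_one]

theorem star_slicePoint {J : A} (hJ : J ∈ imaginaryUnits A) (z : ℂ) :
    star (slicePoint J z) = slicePoint J (conj z) := by
  have h : star J = -J := by rw [eq_neg_iff_add_eq_zero, add_comm]; exact hJ.1
  simp [slicePoint, NormedStarAlternative.star_smul', h]

theorem imPart_slicePoint {J : A} (hJ : J ∈ imaginaryUnits A) (z : ℂ) :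
    imPart (slicePoint J z) = z.im • J := by
  rw [imPart, star_slicePoint hJ]
  simp only [slicePoint, Complex.conj_re, Complex.conj_im, neg_smul]
  module

theorem imaginaryUnits_star {J : A} (hJ : J ∈ imaginaryUnits A) : star J = -J := by
  rw [eq_neg_iff_add_eq_zero, add_comm]; exact hJ.1

theorem imaginaryUnits_mul_mul {J : A} (hJ : J ∈ imaginaryUnits A) (a : A) :
    J * (J * a) = -a := by
  have h := hJ.2
  rw [imaginaryUnits_star hJ, mul_neg] at h
  rw [← NormedStarAlternative.left_alt, ← neg_neg (J * J), h, neg_mul, one_mul]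

theorem hinv_smul_mul_mul {J : A} (hJ : J ∈ imaginaryUnits A) {b : ℝ} (hb : b ≠ 0) (a : A) :
    hinv (b • J) * (J * a) = b⁻¹ • a := by
  by_cases h1 : (1 : A) = 0
  · have h : ∀ x : A, x = 0 := fun x => by rw [← mul_one x, h1, mul_zero]
    rw [h (hinv (b • J) * (J * a)), h (b⁻¹ • a)]
  · have hn : ‖J‖ ^ 2 = 1 := by
      have h := (NormedStarAlternative.mul_star' J).symm.trans hJ.2
      have h' : (‖J‖ ^ 2 - 1) • (1 : A) = 0 := by rw [sub_smul, h, one_smul, sub_self]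
      exact sub_eq_zero.1 ((smul_eq_zero.1 h').resolve_right h1)
    rw [hinv, norm_smul, mul_pow, hn, mul_one, Real.norm_eq_abs, sq_abs,
      NormedStarAlternative.star_smul', imaginaryUnits_star hJ,
      NormedStarAlternative.smul_mul', NormedStarAlternative.smul_mul', neg_mul,
      imaginaryUnits_mul_mul hJ, neg_neg, smul_smul]
    congr 1
    field_simp

theorem sphericalValue_slicePoint {D : Set ℂ} (hD : ∀ z ∈ D, conj z ∈ D) {F₁ F₂ : ℂ → A}
    {f : A → A} (hF : IsStem D F₁ F₂) (hf : Induces D F₁ F₂ f) {z : ℂ} (hz : z ∈ D) {J : A}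
    (hJ : J ∈ imaginaryUnits A) : sphericalValue f (slicePoint J z) = F₁ z := by
  rw [sphericalValue, star_slicePoint hJ, hf z hz J hJ, hf (conj z) (hD z hz) J hJ,
    hF.even z hz, hF.odd z hz, mul_neg]
  module

theorem sphericalDerivative_slicePoint {D : Set ℂ} (hD : ∀ z ∈ D, conj z ∈ D) {F₁ F₂ : ℂ → A}
    {f : A → A} (hF : IsStem D F₁ F₂) (hf : Induces D F₁ F₂ f) {z : ℂ} (hz : z ∈ D)
    (hz0 : z.im ≠ 0) {J : A} (hJ : J ∈ imaginaryUnits A) :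
    sphericalDerivative f (slicePoint J z) = z.im⁻¹ • F₂ z := by
  have h : F₁ z + J * F₂ z - (F₁ z + -(J * F₂ z)) = (2 : ℝ) • (J * F₂ z) := by module
  rw [sphericalDerivative, imPart_slicePoint hJ, star_slicePoint hJ, hf z hz J hJ,
    hf (conj z) (hD z hz) J hJ, hF.even z hz, hF.odd z hz, mul_neg, h,
    NormedStarAlternative.mul_smul', hinv_smul_mul_mul hJ hz0, smul_smul]
  norm_num

theorem induces_sliceConj {D : Set ℂ} (hD : ∀ z ∈ D, conj z ∈ D) {F₁ F₂ : ℂ → A} {f : A → A}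
    (hF : IsStem D F₁ F₂) (hf : Induces D F₁ F₂ f) :
    Induces D (fun z => star (F₁ z)) (fun z => star (F₂ z)) (sliceConj f) := by
  intro z hz J hJ
  rw [sliceConj, sphericalValue_slicePoint hD hF hf hz hJ, imPart_slicePoint hJ]
  congr 1
  by_cases h0 : z.im = 0
  · have h2 : F₂ z = 0 := by
      have h := hF.odd z hz
      rw [Complex.conj_eq_iff_im.2 h0, eq_neg_iff_add_eq_zero, ← two_smul ℝ] at h
      exact (smul_eq_zero.1 h).resolve_left two_ne_zero
    simp only [h0, h2, zero_smul, zero_mul, star_zero, mul_zero]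
  · rw [sphericalDerivative_slicePoint hD hF hf hz h0 hJ, NormedStarAlternative.star_smul',
      NormedStarAlternative.mul_smul', NormedStarAlternative.smul_mul', smul_smul,
      inv_mul_cancel₀ h0, one_smul]

end Facts

end SliceAnalysis

end

open SliceAnalysis

/-! The obstacle is that `1/f` is not available slice by slice: inverting `f` moves a point to
another slice. Let `f₀ = f(x₀)` with `x₀ = α + βJ`, let `J' = f₀⁻¹ J f₀`, and let `p = F₁ᶜ + J' F₂ᶜ`
be `fᶜ` on the slice of `J'`. The associator hypothesis amounts to `(K, F₁, F₂) = 0` for every unit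
`K` (`associator_stem_eq_zero`). Together with the Moufang identities it gives `f₀ p(z) = N(z)`,
read in `ℂ_J`, where `N = F Fᶜ` is a scalar holomorphic function (`mul_conj_slice`). Exchanging `f`
and `fᶜ`, `p(w)` times the value of `f` over `w` on the slice of `q(w) = p(w)⁻¹ J' p(w)` is `N(w)`
in `ℂ_J'`.

Now `q(z) = J`, so the moving points `Re w + (Im w) q(w)` stay near `x₀`, and minimality of `|f|`
makes `|p/N|` locally maximal at `z`. As `p/N` is holomorphic for left multiplication by `J'`, the
maximum principle gives `p = N c` near `z`. Since `N` commutes with `J'`, it follows that `q = J`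
there, and `f = c⁻¹` on the slice of `J` near `z`. The identity theorem and the symmetry of the stem
function then spread this over the domain.

The argument needs `N(z) ≠ 0`. If `N(z) = 0`, then `f` vanishes somewhere on the sphere of `x₀`, and
on that sphere `|f|` is proportional to the distance to the zero. In positive dimension such a
distance has no other local minimum, so `f₀ = 0`, a contradiction
(`stemNorm_ne_zero_of_isLocalMinOn_units`). For `ℂ` the sphere is `{i, -i}` and this fails; there
the slice is the whole algebra and the classical minimum principle applies. -/

namespace StarAlternative

/-! ### Alternative algebras with conjugation: Moufang identities, norm, conjugation of units. -/

section Identities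

variable {A : Type} [NormedStarAlternative A]

theorem smul_mul' (r : ℝ) (x y : A) : (r • x) * y = r • (x * y) :=
  NormedStarAlternative.smul_mul' r x y

theorem mul_smul' (r : ℝ) (x y : A) : x * (r • y) = r • (x * y) :=
  NormedStarAlternative.mul_smul' r x y

theorem star_smul' (r : ℝ) (x : A) : star (r • x) = r • star x :=
  NormedStarAlternative.star_smul' r x

theorem left_alt (x y : A) : (x * x) * y = x * (x * y) := NormedStarAlternative.left_alt x y

theorem mul_star' (x : A) : x * star x = (‖x‖ ^ 2) • (1 : A) := NormedStarAlternative.mul_star' x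

theorem mul_star_linearized (x y : A) :
    x * star y + y * star x = (‖x + y‖ ^ 2 - ‖x‖ ^ 2 - ‖y‖ ^ 2) • (1 : A) := by
  have h := mul_star' (x + y)
  rw [star_add, mul_add, add_mul, add_mul, mul_star' x, mul_star' y] at h
  rw [sub_smul, sub_smul, ← h]
  abel

/-- The trace of an element, as a real number. -/
noncomputable def trace (x : A) : ℝ := ‖x + 1‖ ^ 2 - ‖x‖ ^ 2 - ‖(1 : A)‖ ^ 2

theorem star_eq (x : A) : star x = trace x • (1 : A) - x := by
  have h := mul_star_linearized x 1
  rw [star_one, mul_one, one_mul] at h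
  rw [trace, ← h]
  abel

theorem star_mul_self (x : A) : star x * x = (‖x‖ ^ 2) • (1 : A) := by
  rw [← mul_star' x, star_eq x, sub_mul, mul_sub, smul_mul', mul_smul', one_mul, mul_one]

theorem right_alt (x y : A) : y * (x * x) = (y * x) * x := by
  have h := congrArg star (left_alt (star x) (star y))
  simpa only [star_mul, star_star] using h

theorem left_alt_linearized (x y z : A) :
    (x * y) * z + (y * x) * z = x * (y * z) + y * (x * z) := by
  have h := left_alt (x + y) z
  simp only [add_mul, mul_add, left_alt x, left_alt y] at h
  have h' : x * (x * z) + (y * x * z + x * y * z) + y * (y * z) =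
      x * (x * z) + (y * (x * z) + x * (y * z)) + y * (y * z) := by
    refine Eq.trans ?_ (h.trans ?_) <;> abel
  have h'' := add_left_cancel (add_right_cancel h')
  rw [add_comm, h'', add_comm]

theorem right_alt_linearized (x y z : A) :
    z * (x * y) + z * (y * x) = (z * x) * y + (z * y) * x := by
  have h := congrArg star (left_alt_linearized (star y) (star x) (star z))
  simp only [star_mul, star_star, star_add] at h
  rw [h, add_comm]

theorem associator_swap_left (x y z : A) : associator x y z = -associator y x z := by
  rw [eq_neg_iff_add_eq_zero, associator, associator]
  have h := left_alt_linearized x y z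
  rw [← sub_eq_zero] at h
  rw [← h]; abel

theorem associator_swap_right (x y z : A) : associator x y z = -associator x z y := by
  rw [eq_neg_iff_add_eq_zero, associator, associator]
  have h := right_alt_linearized y z x
  rw [eq_comm, ← sub_eq_zero] at h
  rw [← h]; abel

theorem associator_rotate (x y z : A) : associator x y z = associator y z x := by
  rw [associator_swap_left, associator_swap_right, neg_neg]

theorem flexible (x y : A) : (x * y) * x = x * (y * x) := by
  have h : associator x y x = 0 := by
    rw [associator_swap_left, associator, right_alt, sub_self, neg_zero]
  exact sub_eq_zero.1 h

/-- Follows from the alternating associator and linearized right alternativity, the latter used with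
left factors `x * x` and `x`. -/
theorem left_moufang (x a y : A) : (x * (a * x)) * y = x * (a * (x * y)) := by
  have h1 : associator (x * a) x y = -associator x (x * a) y := associator_swap_left _ _ _
  have h2 : associator x a (x * y) = -associator x (x * y) a := associator_swap_right _ _ _
  have h3 := right_alt_linearized a y (x * x)
  have h4 : x * (x * (a * y) + x * (y * a)) = x * ((x * a) * y + (x * y) * a) :=
    congrArg (x * ·) (right_alt_linearized a y x)
  simp only [associator] at h1 h2
  simp only [left_alt, mul_add] at h3 h4
  rw [← flexible]
  rw [← sub_eq_zero] at *
  have key : x * a * x * y - x * (a * (x * y)) =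
    (x * a * x * y - x * a * (x * y) - -(x * (x * a) * y - x * (x * a * y))) +
    (x * a * (x * y) - x * (a * (x * y)) - -(x * (x * y) * a - x * (x * y * a))) +
    (x * (x * (a * y)) + x * (x * (y * a)) - (x * (x * a) * y + x * (x * y) * a)) -
    (x * (x * (a * y)) + x * (x * (y * a)) - (x * (x * a * y) + x * (x * y * a))) := by abel
  rw [key, h1, h2, h3, h4]
  simp

theorem middle_moufang (x y a : A) : (x * y) * (a * x) = x * ((y * a) * x) := by
  have h1 : associator x y (a * x) = -associator x (a * x) y := associator_swap_right _ _ _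
  have h2 : x * associator a x y = x * associator y a x :=
    congrArg (x * ·) (associator_rotate y a x).symm
  simp only [associator, left_moufang, mul_sub] at h1 h2
  rw [← sub_eq_zero] at *
  have key : x * y * (a * x) - x * (y * a * x) =
    (x * y * (a * x) - x * (y * (a * x)) - -(x * (a * (x * y)) - x * (a * x * y))) +
    (x * (a * x * y) - x * (a * (x * y)) - (x * (y * a * x) - x * (y * (a * x)))) := by abel
  rw [key, h1, h2, add_zero]

theorem star_mul_cancel (x y : A) : star x * (x * y) = (‖x‖ ^ 2) • y := by
  have h : (star x * x) * y = (‖x‖ ^ 2) • y := by rw [star_mul_self, smul_mul', one_mul]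
  rw [← h, star_eq x, sub_mul, sub_mul, sub_mul, smul_mul', smul_mul', smul_mul', one_mul,
    one_mul, left_alt]

theorem mul_star_cancel (x y : A) : x * (star x * y) = (‖x‖ ^ 2) • y := by
  rw [← star_mul_cancel, star_eq x, sub_mul, sub_mul, mul_sub, smul_mul', smul_mul', mul_smul',
    one_mul, one_mul]

theorem norm_star (x : A) : ‖star x‖ = ‖x‖ := by
  -- The zero ring is not excluded here; in it, comparing multiples of `1` gives no information.
  by_cases h1 : (1 : A) = 0
  · have h : ∀ x : A, x = 0 := fun x => by rw [← mul_one x, h1, mul_zero]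
    rw [h (star x), h x]
  · have h := mul_star' (star x)
    rw [star_star, star_mul_self] at h
    have h' := smul_left_injective ℝ h1 h
    exact ((sq_eq_sq₀ (norm_nonneg _) (norm_nonneg _)).1 h').symm

theorem mul_mul_star_cancel (x y : A) : (y * x) * star x = (‖x‖ ^ 2) • y := by
  have h := congrArg star (mul_star_cancel x (star y))
  simpa only [star_mul, star_star, star_smul'] using h

/-- Replacing `xᶜ` by `t - x`, with `t` the trace, reduces `(xy)(yᶜxᶜ)` to `(xy)yᶜ` and `(xy)(yᶜx)`;
middle Moufang computes the second. -/
theorem norm_mul' (x y : A) : ‖x * y‖ = ‖x‖ * ‖y‖ := by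
  by_cases h1 : (1 : A) = 0
  · have h : ∀ x : A, x = 0 := fun x => by rw [← mul_one x, h1, mul_zero]
    rw [h (x * y), h x, norm_zero, zero_mul]
  · have h : (x * y) * star (x * y) = (‖x‖ ^ 2 * ‖y‖ ^ 2) • (1 : A) := by
      have h2 : (x * y) * (star y * x) = (‖y‖ ^ 2) • (x * x) := by
        rw [middle_moufang, mul_star', smul_mul', one_mul, mul_smul']
      rw [star_mul, star_eq x, mul_sub, mul_smul', mul_one, mul_sub, mul_smul',
        mul_mul_star_cancel, h2, mul_smul, smul_comm, ← smul_sub, smul_comm (‖x‖ ^ 2),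
        ← mul_star' x, star_eq x, mul_sub, mul_smul', mul_one]
    rw [mul_star'] at h
    have h' := smul_left_injective ℝ h1 h
    rw [← sq_eq_sq₀ (norm_nonneg _) (by positivity), mul_pow, ← h']

theorem star_mul_mul_eq (x y : A) : (star x * y) * x = star x * (y * x) := by
  rw [star_eq x, sub_mul, sub_mul, sub_mul, smul_mul', smul_mul', smul_mul', one_mul, one_mul,
    flexible]

theorem associator_star_middle (x y z : A) : associator x (star y) z = -associator x y z := by
  simp only [associator, star_eq y, mul_sub, sub_mul, mul_smul', smul_mul', mul_one, one_mul]
  abel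

theorem associator_star_right (x y z : A) : associator x y (star z) = -associator x y z := by
  simp only [associator, star_eq z, mul_sub, mul_smul', mul_one]
  abel

theorem associator_mul_self_middle (x y z : A) :
    associator x (y * x) z = x * associator x y z := by
  have h : x * associator x y z = x * -associator y x z :=
    congrArg (x * ·) (associator_swap_left x y z)
  rw [h, associator, associator, left_moufang, mul_neg, mul_sub, neg_sub]

theorem imaginaryUnits_mul_self {J : A} (hJ : J ∈ imaginaryUnits A) : J * J = -1 := by
  have h := imaginaryUnits_mul_mul hJ 1
  rwa [mul_one] at h

/-- This removes the terms in `J * F₂`, so that only the associator of `J`, `F₁`, `F₂` matters. -/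
theorem associator_mul_self_right (x y : A) : associator x (x * y) y = 0 := by
  have h : associator y x x = 0 := by rw [associator, right_alt, sub_self]
  rw [associator_rotate, associator_rotate, associator_swap_right, associator_mul_self_middle, h,
    mul_zero, neg_zero]

/-- Left multiplication as a continuous linear map, jointly in both factors. -/
noncomputable def mulL : A →L[ℝ] A →L[ℝ] A :=
  LinearMap.mkContinuous₂
    (LinearMap.mk₂ ℝ (fun x y : A => x * y) add_mul smul_mul' mul_add mul_smul') 1
    (fun x y => by simp [norm_mul'])

@[simp] theorem mulL_apply (x y : A) : mulL x y = x * y := rfl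

/-- The conjugation as a continuous linear map. -/
noncomputable def starL : A →L[ℝ] A :=
  LinearMap.mkContinuous
    { toFun := star, map_add' := star_add, map_smul' := star_smul' } 1
    (fun x => by simp [norm_star])

@[simp] theorem starL_apply (x : A) : starL x = star x := rfl

instance : ContinuousMul A := ⟨(mulL (A := A)).continuous₂⟩

instance : ContinuousStar A := ⟨(starL (A := A)).continuous⟩

/-- The unit `p⁻¹ J p`. -/
noncomputable def conjUnit (J p : A) : A := (‖p‖ ^ 2)⁻¹ • (star p * (J * p))

/-- Here `p = f⁻¹ν` with `ν ∈ ℂ_J`, so only `f` and `J` are involved and both sides reduce to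
`f⁻¹(Jν)`. -/
theorem mul_eq_mul_of_mul_eq_slicePoint {J f p : A} {ν : ℂ} (hJ : J ∈ imaginaryUnits A)
    (hf : f ≠ 0) (h : f * p = slicePoint J ν) : conjUnit J f * p = p * J := by
  have hf' : ‖f‖ ≠ 0 := norm_ne_zero_iff.2 hf
  have hp : p = (‖f‖ ^ 2)⁻¹ • (star f * slicePoint J ν) := by
    rw [← h, star_mul_cancel, smul_smul, inv_mul_cancel₀ (by positivity), one_smul]
  have h1 : (star f * (J * f)) * star f = (‖f‖ ^ 2) • (star f * J) := by
    rw [← star_mul_mul_eq, mul_mul_star_cancel]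
  have h2 : (star f * (J * f)) * (star f * J) = -((‖f‖ ^ 2) • star f) := by
    rw [← star_mul_mul_eq, flexible, mul_star_cancel, mul_smul', ← right_alt,
      imaginaryUnits_mul_self hJ, mul_neg, mul_one, smul_neg]
  rw [hp, conjUnit, slicePoint]
  simp only [smul_mul', mul_smul', mul_add, add_mul, mul_one, h1, h2, ← right_alt,
    imaginaryUnits_mul_self hJ, mul_neg]
  simp only [smul_add, smul_neg, smul_smul]
  congr 2 <;> field_simp

/-- Writing `pᶜ = t - p`, the associator hypothesis handles the term in `t`, and with left Moufang
the term in `p`. -/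
theorem mul_conjUnit_mul {J p w : A} (hp : p ≠ 0) (h : associator J p w = 0) :
    p * (conjUnit J p * w) = J * (p * w) := by
  have hp' : ‖p‖ ≠ 0 := norm_ne_zero_iff.2 hp
  rw [associator, sub_eq_zero] at h
  have h1 : (star p * (J * p)) * w = star p * (J * (p * w)) := by
    rw [star_eq, sub_mul, sub_mul, sub_mul, smul_mul', smul_mul', smul_mul', one_mul, one_mul,
      h, left_moufang]
  rw [conjUnit, smul_mul', h1, mul_smul', mul_star_cancel, smul_smul, inv_mul_cancel₀ (by positivity),
    one_smul]

theorem conjUnit_conjUnit {J f p : A} {ν : ℂ} (hJ : J ∈ imaginaryUnits A)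
    (hf : f ≠ 0) (hp : p ≠ 0) (h : f * p = slicePoint J ν) : conjUnit (conjUnit J f) p = J := by
  have hp' : ‖p‖ ≠ 0 := norm_ne_zero_iff.2 hp
  rw [conjUnit, mul_eq_mul_of_mul_eq_slicePoint hJ hf h, star_mul_cancel, smul_smul,
    inv_mul_cancel₀ (by positivity), one_smul]

theorem continuous_slicePoint : Continuous fun q : A × ℂ => slicePoint q.1 q.2 := by
  unfold slicePoint
  fun_prop

theorem slicePoint_mem_circularization {D : Set ℂ} {z : ℂ} (hz : z ∈ D) {J : A}
    (hJ : J ∈ imaginaryUnits A) : slicePoint J z ∈ circularization A D := ⟨z, hz, J, hJ, rfl⟩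

theorem slicePoint_neg (J : A) (w : ℂ) : slicePoint (-J) w = slicePoint J (conj w) := by
  simp [slicePoint]

end Identities

/-- The Euclidean inner product. -/
noncomputable instance innerProductSpace {A : Type} [NormedStarAlternative A] [Nontrivial A] :
    InnerProductSpace ℝ A where
  inner x y := (‖x + y‖ ^ 2 - ‖x‖ ^ 2 - ‖y‖ ^ 2) / 2
  norm_sq_eq_re_inner x := by
    have h : ‖x + x‖ = 2 * ‖x‖ := by rw [← two_smul ℝ x, norm_smul]; norm_num
    simp only [h, RCLike.re_to_real]
    ring
  conj_inner_symm x y := by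
    simp only [conj_trivial, add_comm y x]
    ring
  add_left x y z := by
    have h1 : (1 : A) ≠ 0 := by
      intro h
      obtain ⟨a, ha⟩ := exists_ne (0 : A)
      exact ha (by rw [← mul_one a, h, mul_zero])
    have h : (‖x + y + z‖ ^ 2 - ‖x + y‖ ^ 2 - ‖z‖ ^ 2) =
        (‖x + z‖ ^ 2 - ‖x‖ ^ 2 - ‖z‖ ^ 2) + (‖y + z‖ ^ 2 - ‖y‖ ^ 2 - ‖z‖ ^ 2) := by
      -- On multiples of `1`, polarization becomes `x * star y + y * star x`, which is visibly
      -- biadditive.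
      apply smul_left_injective ℝ h1
      simp only [add_smul, ← mul_star_linearized, star_add, add_mul, mul_add]
      abel
    rw [h]; ring
  smul_left x y r := by
    have h1 : (1 : A) ≠ 0 := by
      intro h
      obtain ⟨a, ha⟩ := exists_ne (0 : A)
      exact ha (by rw [← mul_one a, h, mul_zero])
    have h : (‖r • x + y‖ ^ 2 - ‖r • x‖ ^ 2 - ‖y‖ ^ 2) =
        r * (‖x + y‖ ^ 2 - ‖x‖ ^ 2 - ‖y‖ ^ 2) := by
      apply smul_left_injective ℝ h1
      simp only [mul_smul, ← mul_star_linearized, star_smul', smul_mul', mul_smul', smul_add]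
    simp only [h, conj_trivial]; ring

/-! ### Inner product, normal function, and complex coordinates on a slice. -/

section Basic

variable {A : Type} [NormedStarAlternative A] [Nontrivial A]

theorem one_ne_zero' : (1 : A) ≠ 0 := by
  intro h
  obtain ⟨a, ha⟩ := exists_ne (0 : A)
  exact ha (by rw [← mul_one a, h, mul_zero])

theorem mul_star_add_mul_star (x y : A) :
    x * star y + y * star x = (2 * inner ℝ x y) • (1 : A) := by
  rw [mul_star_linearized]
  congr 1
  change _ = 2 * ((‖x + y‖ ^ 2 - ‖x‖ ^ 2 - ‖y‖ ^ 2) / 2)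
  ring

theorem inner_star_star (x y : A) : inner ℝ (star x) (star y) = inner ℝ x y := by
  change (‖star x + star y‖ ^ 2 - _ - _) / 2 = (‖x + y‖ ^ 2 - ‖x‖ ^ 2 - ‖y‖ ^ 2) / 2
  rw [← star_add, norm_star, norm_star, norm_star]

theorem norm_one' : ‖(1 : A)‖ = 1 := by
  have h := norm_mul' (1 : A) 1
  rw [mul_one] at h
  have h1 : ‖(1 : A)‖ ≠ 0 := norm_ne_zero_iff.2 one_ne_zero'
  exact (mul_left_cancel₀ h1 (by rw [mul_one, ← h])).symm

theorem norm_imaginaryUnit {J : A} (hJ : J ∈ imaginaryUnits A) : ‖J‖ = 1 := by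
  have h := (mul_star' J).symm.trans hJ.2
  rw [← one_smul ℝ (1 : A), smul_smul, mul_one] at h
  have h' := smul_left_injective ℝ one_ne_zero' h
  exact (pow_eq_one_iff_of_nonneg (norm_nonneg J) two_ne_zero).1 h'

theorem mem_imaginaryUnits_iff {J : A} : J ∈ imaginaryUnits A ↔ star J = -J ∧ ‖J‖ = 1 := by
  refine ⟨fun h => ⟨imaginaryUnits_star h, norm_imaginaryUnit h⟩, fun h => ⟨?_, ?_⟩⟩
  · rw [h.1, add_neg_cancel]
  · rw [mul_star', h.2]; simp

theorem inner_mul_left_mul_left (x y z : A) :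
    inner ℝ (x * y) (x * z) = ‖x‖ ^ 2 * inner ℝ y z := by
  change (‖x * y + x * z‖ ^ 2 - _ - _) / 2 = _ * ((‖y + z‖ ^ 2 - ‖y‖ ^ 2 - ‖z‖ ^ 2) / 2)
  rw [← mul_add, norm_mul', norm_mul', norm_mul']
  ring

theorem inner_unit_mul {J : A} (hJ : J ∈ imaginaryUnits A) (x y : A) :
    inner ℝ (J * x) y = -inner ℝ x (J * y) := by
  have h := inner_mul_left_mul_left J (J * x) y
  rw [imaginaryUnits_mul_mul hJ, norm_imaginaryUnit hJ, inner_neg_left] at h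
  linarith

theorem inner_unit_mul_self {J : A} (hJ : J ∈ imaginaryUnits A) (x : A) :
    inner ℝ (J * x) x = (0 : ℝ) := by
  have h := inner_unit_mul hJ x x
  rw [real_inner_comm x (J * x)] at h
  have := real_inner_comm x (J * x)
  linarith

theorem inner_one_unit {J : A} (hJ : J ∈ imaginaryUnits A) : inner ℝ (1 : A) J = (0 : ℝ) := by
  have h := inner_unit_mul_self hJ (1 : A)
  rwa [mul_one, real_inner_comm] at h

theorem norm_slicePoint {J : A} (hJ : J ∈ imaginaryUnits A) (z : ℂ) :
    ‖slicePoint J z‖ = ‖z‖ := by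
  have h : ‖slicePoint J z‖ ^ 2 = ‖z‖ ^ 2 := by
    rw [slicePoint, norm_add_sq_real, inner_smul_left, inner_smul_right, inner_one_unit hJ,
      norm_smul, norm_smul, norm_one', norm_imaginaryUnit hJ, Complex.sq_norm,
      Complex.normSq_apply, Real.norm_eq_abs, Real.norm_eq_abs]
    simp only [mul_one, sq_abs, mul_zero]
    ring
  exact (sq_eq_sq₀ (norm_nonneg _) (norm_nonneg _)).1 h

theorem conjUnit_mem {J p : A} (hJ : J ∈ imaginaryUnits A) (hp : p ≠ 0) :
    conjUnit J p ∈ imaginaryUnits A := by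
  have hp' : ‖p‖ ≠ 0 := norm_ne_zero_iff.2 hp
  refine mem_imaginaryUnits_iff.2 ⟨?_, ?_⟩
  · rw [conjUnit, star_smul', star_mul, star_mul, star_star, imaginaryUnits_star hJ, mul_neg,
      neg_mul, star_mul_mul_eq, smul_neg]
  · rw [conjUnit, norm_smul, norm_mul', norm_mul', norm_star, norm_imaginaryUnit hJ, norm_inv,
      norm_pow, norm_norm]
    field_simp

/-- The normal function: `F Fᶜ` for `F = a + ι b`, as a complex number. -/
noncomputable def stemNorm (a b : A) : ℂ := ⟨‖a‖ ^ 2 - ‖b‖ ^ 2, 2 * inner ℝ a b⟩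

theorem stemNorm_star (a b : A) : stemNorm (star a) (star b) = stemNorm a b := by
  rw [stemNorm, stemNorm, norm_star, norm_star, inner_star_star]

/-- With `p = a + Jb`, the conjugated unit is chosen so that `p((p⁻¹Jp)bᶜ) = J(p bᶜ)`. What remains
is `|a|² + J(abᶜ + baᶜ) - |b|²`. -/
theorem mul_conj_slice {J a b : A} (hJ : J ∈ imaginaryUnits A) (hp : a + J * b ≠ 0)
    (h : associator J a b = 0) :
    (a + J * b) * (star a + conjUnit J (a + J * b) * star b) = slicePoint J (stemNorm a b) := by
  have h2 : associator J (a + J * b) (star b) = 0 := by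
    have h3 : associator J (a + J * b) b = associator J a b + associator J (J * b) b := by
      simp only [associator, mul_add, add_mul]; abel
    rw [associator_star_right, h3, h, associator_mul_self_right, add_zero, neg_zero]
  have h4 : (J * b) * star a = J * (b * star a) := by
    have : associator J b (star a) = 0 := by
      rw [associator_star_right, associator_swap_right, h, neg_zero, neg_zero]
    exact sub_eq_zero.1 this
  rw [mul_add, mul_conjUnit_mul hp h2, add_mul, add_mul, mul_mul_star_cancel, mul_star', h4,
    mul_add, add_assoc, ← add_assoc (J * _), ← mul_add, add_comm (b * star a),
    mul_star_add_mul_star, mul_smul', mul_smul', imaginaryUnits_mul_self hJ, mul_one, slicePoint]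
  simp only [stemNorm]
  module

/-- Elements of `ℂ_J` commute with `J`, so they cancel in the conjugation. -/
theorem conjUnit_slicePoint_mul {J c : A} {ν : ℂ} (hJ : J ∈ imaginaryUnits A) (hν : ν ≠ 0) :
    conjUnit J (slicePoint J ν * c) = conjUnit J c := by
  have hν' : ‖ν‖ ≠ 0 := norm_ne_zero_iff.2 hν
  have h1 : (star c * J) * (J * c) = -(star c * c) := by
    have h := star_mul_self (J * c)
    rw [star_mul, imaginaryUnits_star hJ, mul_neg, neg_mul, norm_mul', norm_imaginaryUnit hJ,
      one_mul, ← star_mul_self c] at h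
    rw [← h, neg_neg]
  have h2 : ‖ν‖ ^ 2 = ν.re ^ 2 + ν.im ^ 2 := by
    rw [Complex.sq_norm, Complex.normSq_apply]; ring
  have h3 : star (slicePoint J ν * c) * (J * (slicePoint J ν * c)) =
      (‖ν‖ ^ 2) • (star c * (J * c)) := by
    rw [star_mul, star_slicePoint hJ, slicePoint, slicePoint, h2]
    simp only [Complex.conj_re, Complex.conj_im, add_mul, mul_add, smul_mul', mul_smul', one_mul,
      mul_one, imaginaryUnits_mul_mul hJ, mul_neg, h1, star_mul_mul_eq]
    module
  rw [conjUnit, h3, norm_mul', norm_slicePoint hJ, smul_smul, conjUnit]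
  congr 1
  rw [mul_pow, mul_inv, mul_comm (_⁻¹), mul_assoc, inv_mul_cancel₀ (by positivity), mul_one]

theorem eq_of_slicePoint_mul_mul_eq {J c g : A} {ν : ℂ} (hJ : J ∈ imaginaryUnits A) (hν : ν ≠ 0)
    (hc : c ≠ 0) (h : (slicePoint J ν * c) * g = slicePoint J ν) : g = (‖c‖ ^ 2)⁻¹ • star c := by
  have hν' : ‖ν‖ ≠ 0 := norm_ne_zero_iff.2 hν
  have hc' : ‖c‖ ≠ 0 := norm_ne_zero_iff.2 hc
  have h1 := star_mul_cancel (slicePoint J ν * c) g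
  have h2 := mul_mul_star_cancel (star (slicePoint J ν)) (star c)
  rw [star_star] at h2
  rw [h, star_mul, h2, norm_star, norm_mul', norm_slicePoint hJ] at h1
  have h3 : (‖ν‖ ^ 2) • star c = (‖ν‖ ^ 2) • ((‖c‖ ^ 2) • g) := by
    rw [h1, smul_smul, mul_pow]
  have h4 := smul_right_injective A (by positivity : ‖ν‖ ^ 2 ≠ 0) h3
  rw [h4, smul_smul, inv_mul_cancel₀ (by positivity), one_smul]

/-- The coordinate `⟨a, v⟩ - i ⟨J a, v⟩` of `a`, complex linear for the complex structure
given by left multiplication by `J`. -/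
noncomputable def pairing (J v : A) : A →L[ℝ] ℂ :=
  Complex.ofRealCLM ∘L innerSL ℝ v - Complex.I • (Complex.ofRealCLM ∘L innerSL ℝ v ∘L mulL J)

theorem pairing_apply (J v a : A) :
    pairing J v a = (inner ℝ a v : ℝ) - Complex.I * (inner ℝ (J * a) v : ℝ) := by
  simp [pairing, real_inner_comm]

theorem pairing_re (J v a : A) : (pairing J v a).re = inner ℝ a v := by
  simp [pairing_apply]

theorem pairing_unit_mul {J : A} (hJ : J ∈ imaginaryUnits A) (v a : A) :
    pairing J v (J * a) = Complex.I * pairing J v a := by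
  rw [pairing_apply, pairing_apply, imaginaryUnits_mul_mul hJ, inner_neg_left]
  push_cast
  linear_combination (inner ℝ (J * a) v : ℂ) * Complex.I_sq

theorem pairing_slicePoint_mul {J : A} (hJ : J ∈ imaginaryUnits A) (v a : A) (ν : ℂ) :
    pairing J v (slicePoint J ν * a) = ν * pairing J v a := by
  rw [slicePoint, add_mul, smul_mul', smul_mul', one_mul, map_add, map_smul, map_smul,
    pairing_unit_mul hJ, Complex.real_smul, Complex.real_smul]
  conv_rhs => rw [← Complex.re_add_im ν]
  ring

/-- Rotating `a` by an element of `ℂ_J` makes the pairing real, where Cauchy–Schwarz applies. -/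
theorem norm_pairing_le {J : A} (hJ : J ∈ imaginaryUnits A) (v a : A) :
    ‖pairing J v a‖ ≤ ‖a‖ * ‖v‖ := by
  have h := congrArg Complex.re (pairing_slicePoint_mul hJ v a (conj (pairing J v a)))
  rw [Complex.conj_mul', pairing_re] at h
  have h2 := real_inner_le_norm (slicePoint J (conj (pairing J v a)) * a) v
  rw [h, norm_mul', norm_slicePoint hJ, Complex.norm_conj] at h2
  norm_cast at h2
  by_contra! hlt
  have h3 : 0 < ‖pairing J v a‖ := lt_of_le_of_lt (by positivity) hlt
  nlinarith

theorem pairing_self {J : A} (hJ : J ∈ imaginaryUnits A) (v : A) :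
    pairing J v v = ((‖v‖ ^ 2 : ℝ) : ℂ) := by
  rw [pairing_apply, inner_unit_mul_self hJ, real_inner_self_eq_norm_sq]
  simp

/-- The equality case of Cauchy–Schwarz. -/
theorem eq_of_pairing_eq {J a v : A} (h : ‖a‖ ≤ ‖v‖)
    (h2 : pairing J v a = pairing J v v) : a = v := by
  have h3 := congrArg Complex.re h2
  rw [pairing_re, pairing_re, real_inner_self_eq_norm_sq] at h3
  have h4 : ‖a - v‖ ^ 2 ≤ 0 := by
    rw [norm_sub_sq_real, h3]
    nlinarith [norm_nonneg a]
  exact sub_eq_zero.1 (norm_eq_zero.1 (pow_eq_zero_iff two_ne_zero |>.1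
    (le_antisymm h4 (by positivity))))

end Basic
-- Holomorphy on a slice, the identity theorem and the maximum principle.
section Analysis

variable {A : Type} [NormedStarAlternative A]

/-- Pointwise holomorphy of the stem function `F₁ + ι F₂`. -/
structure HolomorphicStemAt (F₁ F₂ : ℂ → A) (z : ℂ) : Prop where
  fst : DifferentiableAt ℝ F₁ z
  snd : DifferentiableAt ℝ F₂ z
  cr₁ : fderiv ℝ F₁ z 1 = fderiv ℝ F₂ z Complex.I
  cr₂ : fderiv ℝ F₁ z Complex.I = -fderiv ℝ F₂ z 1

variable {F₁ F₂ : ℂ → A} {z : ℂ}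

theorem HolomorphicStemAt.conj_stem (h : HolomorphicStemAt F₁ F₂ z) :
    HolomorphicStemAt (fun w => star (F₁ w)) (fun w => star (F₂ w)) z := by
  have h1 : HasFDerivAt (fun w => star (F₁ w)) ((starL (A := A)).comp (fderiv ℝ F₁ z)) z :=
    (starL (A := A)).hasFDerivAt.comp z h.fst.hasFDerivAt
  have h2 : HasFDerivAt (fun w => star (F₂ w)) ((starL (A := A)).comp (fderiv ℝ F₂ z)) z :=
    (starL (A := A)).hasFDerivAt.comp z h.snd.hasFDerivAt
  refine ⟨h1.differentiableAt, h2.differentiableAt, ?_, ?_⟩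
  · rw [h1.fderiv, h2.fderiv]; simp [h.cr₁]
  · rw [h1.fderiv, h2.fderiv]; simp [h.cr₂]

variable [Nontrivial A]

/-- The Cauchy–Riemann equations say that `F₁ + J F₂` is holomorphic for left multiplication by `J`,
and the pairing is linear for that structure. -/
theorem HolomorphicStemAt.differentiableAt_pairing (h : HolomorphicStemAt F₁ F₂ z) {J : A}
    (hJ : J ∈ imaginaryUnits A) (v : A) :
    DifferentiableAt ℂ (fun w => pairing J v (F₁ w + J * F₂ w)) z := by
  have h1 : HasFDerivAt (fun w => pairing J v (F₁ w + J * F₂ w))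
      ((pairing J v).comp (fderiv ℝ F₁ z + (mulL J).comp (fderiv ℝ F₂ z))) z :=
    (pairing J v).hasFDerivAt.comp z
      (h.fst.hasFDerivAt.add ((mulL J).hasFDerivAt.comp z h.snd.hasFDerivAt))
  refine differentiableAt_complex_iff_differentiableAt_real.2 ⟨h1.differentiableAt, ?_⟩
  rw [h1.fderiv]
  simp only [ContinuousLinearMap.comp_apply, add_apply, mulL_apply, h.cr₁,
    h.cr₂, smul_eq_mul]
  rw [← pairing_unit_mul hJ, mul_add, imaginaryUnits_mul_mul hJ, add_comm]

theorem HolomorphicStemAt.differentiableAt_stemNorm (h : HolomorphicStemAt F₁ F₂ z) :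
    DifferentiableAt ℂ (fun w => stemNorm (F₁ w) (F₂ w)) z := by
  have h1 := h.fst.hasFDerivAt
  have h2 := h.snd.hasFDerivAt
  have hre := (h1.inner ℝ h1).sub (h2.inner ℝ h2)
  have him := (h1.inner ℝ h2).const_mul (2 : ℝ)
  have hre' := Complex.ofRealCLM.hasFDerivAt.comp z hre
  have him' := (Complex.I • Complex.ofRealCLM).hasFDerivAt.comp z him
  have hN := hre'.add him'
  have hN' := hN.congr_of_eventuallyEq (f₁ := fun w => stemNorm (F₁ w) (F₂ w))
    (Filter.Eventually.of_forall fun w => by apply Complex.ext <;> simp [stemNorm, sq])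
  refine differentiableAt_complex_iff_differentiableAt_real.2 ⟨hN'.differentiableAt, ?_⟩
  rw [hN'.fderiv]
  apply Complex.ext <;>
    simp [fderivInnerCLM_apply, h.cr₁, h.cr₂, real_inner_comm] <;> ring

theorem slice_eqOn_of_eventuallyEq {C : Set ℂ} (hC : IsOpen C) (hC' : IsPreconnected C)
    (hF : ∀ w ∈ C, HolomorphicStemAt F₁ F₂ w) {J : A} (hJ : J ∈ imaginaryUnits A) (hz : z ∈ C)
    {c : A} (h : ∀ᶠ w in 𝓝 z, F₁ w + J * F₂ w = c) : ∀ w ∈ C, F₁ w + J * F₂ w = c := by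
  intro w hw
  refine ext_inner_right ℝ fun v => ?_
  have h1 : AnalyticOnNhd ℂ (fun w => pairing J v (F₁ w + J * F₂ w)) C :=
    DifferentiableOn.analyticOnNhd
      (fun w hw => ((hF w hw).differentiableAt_pairing hJ v).differentiableWithinAt) hC
  have h2 := h1.eqOn_of_preconnected_of_eventuallyEq (analyticOnNhd_const (v := pairing J v c))
    hC' hz (h.mono fun w hw => congrArg (pairing J v) hw)
  have h3 := congrArg Complex.re (h2 hw)
  rwa [pairing_re, pairing_re] at h3

/-- Local constancy at a local maximum of `‖(F₁ + J F₂) / N‖`. -/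
theorem eventually_eq_slicePoint_mul_of_isLocalMax {N : ℂ → ℂ}
    (hF : ∀ᶠ w in 𝓝 z, HolomorphicStemAt F₁ F₂ w) (hN : ∀ᶠ w in 𝓝 z, DifferentiableAt ℂ N w)
    (hN0 : N z ≠ 0) {J : A} (hJ : J ∈ imaginaryUnits A)
    (hmax : ∀ᶠ w in 𝓝 z, ‖F₁ w + J * F₂ w‖ * ‖N z‖ ≤ ‖F₁ z + J * F₂ z‖ * ‖N w‖) :
    ∀ᶠ w in 𝓝 z, F₁ w + J * F₂ w =
      slicePoint J (N w) * (slicePoint J (N z)⁻¹ * (F₁ z + J * F₂ z)) := by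
  set p : ℂ → A := fun w => F₁ w + J * F₂ w with hp
  -- Pairing `p/N` with its own value `c` at `z` gives a scalar function whose modulus is maximal at
  -- `z`; its constancy forces equality in Cauchy–Schwarz.
  set c : A := slicePoint J (N z)⁻¹ * p z with hc
  have hNz : 0 < ‖N z‖ := norm_pos_iff.2 hN0
  have hcn : ‖c‖ = ‖p z‖ / ‖N z‖ := by
    rw [hc, norm_mul', norm_slicePoint hJ, norm_inv]; ring
  have hN1 : ∀ᶠ w in 𝓝 z, N w ≠ 0 := hN.self_of_nhds.continuousAt.eventually_ne hN0
  have hg : ∀ w, pairing J c (slicePoint J (N w)⁻¹ * p w) = (N w)⁻¹ * pairing J c (p w) :=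
    fun w => pairing_slicePoint_mul hJ _ _ _
  have hle : ∀ᶠ w in 𝓝 z, ‖slicePoint J (N w)⁻¹ * p w‖ ≤ ‖c‖ := by
    filter_upwards [hmax, hN1] with w hw hw0
    have hNw : 0 < ‖N w‖ := norm_pos_iff.2 hw0
    rw [norm_mul', norm_slicePoint hJ, norm_inv, hcn, inv_mul_eq_div, div_le_div_iff₀ hNw hNz]
    exact hw
  have hconst : ∀ᶠ w in 𝓝 z,
      (N w)⁻¹ * pairing J c (p w) = (N z)⁻¹ * pairing J c (p z) := by
    refine Complex.eventually_eq_of_isLocalMax_norm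
      (f := fun w => (N w)⁻¹ * pairing J c (p w)) ?_ ?_
    · filter_upwards [hF, hN, hN1] with w h1 h2 h3
      exact (h2.inv h3).mul (h1.differentiableAt_pairing hJ c)
    · filter_upwards [hle] with w hw
      simp only [Function.comp_apply]
      rw [← hg, ← hg, ← hc, pairing_self hJ, Complex.norm_real, Real.norm_of_nonneg (by positivity)]
      exact (norm_pairing_le hJ _ _).trans
        (by rw [sq]; exact mul_le_mul_of_nonneg_right hw (norm_nonneg _))
  filter_upwards [hle, hconst, hN1] with w h1 h2 h3
  have h4 : slicePoint J (N w)⁻¹ * p w = c := eq_of_pairing_eq h1 (by rw [hg, h2, ← hg])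
  rw [← h4]
  refine ext_inner_right ℝ fun v => ?_
  rw [← pairing_re J, ← pairing_re J, pairing_slicePoint_mul hJ, pairing_slicePoint_mul hJ,
    mul_inv_cancel_left₀ h3]

end Analysis
-- Local minima of `|a + L b|` on the sphere of imaginary units.
section Sphere

variable {A : Type} [NormedStarAlternative A] [Nontrivial A]

theorem cos_smul_add_sin_smul_mem {J L : A} (hJ : J ∈ imaginaryUnits A)
    (hL : L ∈ imaginaryUnits A) (h : inner ℝ J L = (0 : ℝ)) (θ : ℝ) :
    Real.cos θ • J + Real.sin θ • L ∈ imaginaryUnits A := by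
  refine mem_imaginaryUnits_iff.2 ⟨?_, ?_⟩
  · rw [star_add, star_smul', star_smul', imaginaryUnits_star hJ, imaginaryUnits_star hL]
    module
  · have h2 : ‖Real.cos θ • J + Real.sin θ • L‖ ^ 2 = 1 := by
      rw [norm_add_sq_real, inner_smul_left, inner_smul_right, h, norm_smul, norm_smul,
        norm_imaginaryUnit hJ, norm_imaginaryUnit hL, mul_one, mul_one, Real.norm_eq_abs,
        Real.norm_eq_abs, sq_abs, sq_abs, mul_zero, mul_zero, mul_zero, add_zero,
        Real.cos_sq_add_sin_sq]
    exact (pow_eq_one_iff_of_nonneg (norm_nonneg _) two_ne_zero).1 h2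

theorem exists_unit_inner_eq_zero
    (hA : ∃ I₁ ∈ imaginaryUnits A, ∃ I₂ ∈ imaginaryUnits A, I₁ * star I₂ + I₂ * star I₁ = 0)
    (J : A) : ∃ L ∈ imaginaryUnits A, inner ℝ J L = (0 : ℝ) := by
  obtain ⟨I₁, h₁, I₂, h₂, h⟩ := hA
  rw [mul_star_add_mul_star, smul_eq_zero, or_iff_left one_ne_zero'] at h
  have h12 : inner ℝ I₁ I₂ = (0 : ℝ) := by linarith
  by_cases h0 : inner ℝ J I₁ = (0 : ℝ)
  · exact ⟨I₁, h₁, h0⟩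
  set a : ℝ := inner ℝ J I₁
  set b : ℝ := inner ℝ J I₂ with hb
  -- The combination of `I₁` and `I₂` orthogonal to `J`; its component along `I₂` is `-a ≠ 0`.
  have hu : b • I₁ - a • I₂ ≠ 0 := by
    intro hu
    have h3 := congrArg (inner ℝ I₂) hu
    rw [inner_sub_right, inner_smul_right, inner_smul_right, real_inner_comm, h12,
      real_inner_self_eq_norm_sq, norm_imaginaryUnit h₂, inner_zero_right] at h3
    exact h0 (by linarith)
  have hu' : ‖b • I₁ - a • I₂‖ ≠ 0 := norm_ne_zero_iff.2 hu
  refine ⟨‖b • I₁ - a • I₂‖⁻¹ • (b • I₁ - a • I₂), mem_imaginaryUnits_iff.2 ⟨?_, ?_⟩, ?_⟩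
  · rw [star_smul', star_sub, star_smul', star_smul', imaginaryUnits_star h₁,
      imaginaryUnits_star h₂]
    module
  · rw [norm_smul, norm_inv, norm_norm, inv_mul_cancel₀ hu']
  · rw [inner_smul_right, inner_sub_right, inner_smul_right, inner_smul_right, ← hb]
    change _ * (b * a - a * b) = 0
    ring

/-- Along great circles through `J`, the first-order condition makes `K` a multiple of `J`, and
comparison with nearby values excludes `K = -J`. -/
theorem eq_of_inner_isLocalMaxOn_units
    (hA : ∃ I₁ ∈ imaginaryUnits A, ∃ I₂ ∈ imaginaryUnits A, I₁ * star I₂ + I₂ * star I₁ = 0)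
    {J K : A} (hJ : J ∈ imaginaryUnits A) (hK : K ∈ imaginaryUnits A)
    (h : ∀ᶠ L in 𝓝[imaginaryUnits A] J, (inner ℝ L K : ℝ) ≤ inner ℝ J K) : J = K := by
  have key : ∀ L ∈ imaginaryUnits A, inner ℝ J L = (0 : ℝ) → ∀ᶠ θ in 𝓝 (0 : ℝ),
      Real.cos θ * inner ℝ J K + Real.sin θ * inner ℝ L K ≤ inner ℝ J K := by
    intro L hL hJL
    have ht : Filter.Tendsto (fun θ : ℝ => Real.cos θ • J + Real.sin θ • L) (𝓝 0)
        (𝓝[imaginaryUnits A] J) := by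
      refine tendsto_nhdsWithin_iff.2 ⟨?_, Filter.Eventually.of_forall fun θ =>
        cos_smul_add_sin_smul_mem hJ hL hJL θ⟩
      have hc : Continuous fun θ : ℝ => Real.cos θ • J + Real.sin θ • L := by fun_prop
      simpa using hc.tendsto 0
    filter_upwards [ht.eventually h] with θ hθ
    rwa [inner_add_left, inner_smul_left, inner_smul_left] at hθ
  have horth : ∀ L ∈ imaginaryUnits A, inner ℝ J L = (0 : ℝ) → inner ℝ L K = (0 : ℝ) := by
    intro L hL hJL
    have hmax : IsLocalMax (fun θ : ℝ => Real.cos θ * inner ℝ J K + Real.sin θ * inner ℝ L K) 0 := by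
      filter_upwards [key L hL hJL] with θ hθ
      simpa using hθ
    have hd : HasDerivAt (fun θ : ℝ => Real.cos θ * inner ℝ J K + Real.sin θ * inner ℝ L K)
        (-Real.sin 0 * inner ℝ J K + Real.cos 0 * inner ℝ L K) 0 :=
      ((Real.hasDerivAt_cos 0).mul_const _).add ((Real.hasDerivAt_sin 0).mul_const _)
    simpa using hmax.hasDerivAt_eq_zero hd
  -- On a great circle the function is now `cos θ` times its value at `J`; a negative value would
  -- increase away from `θ = 0`. A unit orthogonal to `J` is needed, which `ℂ` lacks.
  have hpos : (0 : ℝ) ≤ inner ℝ J K := by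
    obtain ⟨L, hL, hJL⟩ := exists_unit_inner_eq_zero hA J
    have h1 := key L hL hJL
    rw [horth L hL hJL] at h1
    obtain ⟨ε, hε, h2⟩ := Metric.eventually_nhds_iff.1 h1
    have hm : 0 < min (ε / 2) 1 := by positivity
    have h3 := h2 (y := min (ε / 2) 1) (by
      rw [Real.dist_eq, sub_zero, abs_of_pos hm]
      exact (min_le_left _ _).trans_lt (by linarith))
    have h4 : Real.cos (min (ε / 2) 1) < 1 := by
      have h5 := Real.cos_lt_cos_of_nonneg_of_le_pi_div_two le_rfl
        ((min_le_right (ε / 2) 1).trans (by linarith [Real.pi_gt_three])) hm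
      rwa [Real.cos_zero] at h5
    nlinarith
  set c : ℝ := inner ℝ J K with hc
  have hJJ : inner ℝ J J = (1 : ℝ) := by
    rw [real_inner_self_eq_norm_sq, norm_imaginaryUnit hJ, one_pow]
  have hu : K - c • J = 0 := by
    by_contra hu
    have hu' : ‖K - c • J‖ ≠ 0 := norm_ne_zero_iff.2 hu
    have hJu : inner ℝ J (K - c • J) = (0 : ℝ) := by
      rw [inner_sub_right, inner_smul_right, hJJ, ← hc]; ring
    have h1 := horth (‖K - c • J‖⁻¹ • (K - c • J)) (mem_imaginaryUnits_iff.2 ⟨by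
        rw [star_smul', star_sub, star_smul', imaginaryUnits_star hJ, imaginaryUnits_star hK]
        module, by rw [norm_smul, norm_inv, norm_norm, inv_mul_cancel₀ hu']⟩)
      (by rw [inner_smul_right, hJu, mul_zero])
    rw [inner_smul_left] at h1
    have h2 : inner ℝ (K - c • J) K = (0 : ℝ) :=
      (mul_eq_zero.1 h1).resolve_left (inv_ne_zero hu')
    have h3 : inner ℝ (K - c • J) (K - c • J) = (0 : ℝ) := by
      rw [inner_sub_right, h2, inner_smul_right, real_inner_comm, hJu]; ring
    exact hu (inner_self_eq_zero.1 h3)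
  rw [sub_eq_zero] at hu
  have h1 := norm_imaginaryUnit hK
  rw [hu, norm_smul, norm_imaginaryUnit hJ, Real.norm_of_nonneg hpos, mul_one] at h1
  rw [hu, h1, one_smul]

theorem stemNorm_ne_zero_of_isLocalMinOn_units
    (hA : ∃ I₁ ∈ imaginaryUnits A, ∃ I₂ ∈ imaginaryUnits A, I₁ * star I₂ + I₂ * star I₁ = 0)
    {J a b : A} (hJ : J ∈ imaginaryUnits A) (hne : a + J * b ≠ 0)
    (h : ∀ᶠ L in 𝓝[imaginaryUnits A] J, ‖a + J * b‖ ≤ ‖a + L * b‖) : stemNorm a b ≠ 0 := by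
  intro h0
  have hre : ‖a‖ ^ 2 - ‖b‖ ^ 2 = 0 := congrArg Complex.re h0
  have him : 2 * inner ℝ a b = (0 : ℝ) := congrArg Complex.im h0
  have hab : ‖a‖ = ‖b‖ := by
    rw [← sq_eq_sq₀ (norm_nonneg _) (norm_nonneg _)]; linarith
  by_cases hb : b = 0
  · rw [hb, norm_zero, norm_eq_zero] at hab
    exact hne (by rw [hab, hb, mul_zero, add_zero])
  have hb' : ‖b‖ ≠ 0 := norm_ne_zero_iff.2 hb
  -- `K = -a b⁻¹` is the zero of `L ↦ a + L b`: imaginary because `a ⊥ b`, of norm one because `‖a‖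
  -- = ‖b‖`.
  set K : A := -((‖b‖ ^ 2)⁻¹ • (a * star b)) with hKdef
  have hKb : K * b = -a := by
    have h1 := mul_mul_star_cancel (star b) a
    rw [star_star, norm_star] at h1
    rw [hKdef, neg_mul, smul_mul', h1, smul_smul, inv_mul_cancel₀ (by positivity), one_smul]
  have hK : K ∈ imaginaryUnits A := by
    refine mem_imaginaryUnits_iff.2 ⟨?_, ?_⟩
    · have h1 := mul_star_add_mul_star a b
      rw [him, zero_smul, ← eq_neg_iff_add_eq_zero] at h1
      rw [hKdef, star_neg, star_smul', star_mul, star_star, h1, smul_neg, neg_neg]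
    · rw [hKdef, norm_neg, norm_smul, norm_mul', norm_star, hab, norm_inv, norm_pow, norm_norm]
      field_simp
  have hf : ∀ L : A, ‖a + L * b‖ = ‖L - K‖ * ‖b‖ := fun L => by
    rw [← norm_mul', sub_mul, hKb, sub_neg_eq_add, add_comm]
  have hJK : J = K := by
    refine eq_of_inner_isLocalMaxOn_units hA hJ hK ?_
    filter_upwards [h, self_mem_nhdsWithin] with L hL hLu
    rw [hf, hf] at hL
    have h1 := le_of_mul_le_mul_right hL (by positivity)
    have h2 := pow_le_pow_left₀ (norm_nonneg _) h1 2
    rw [norm_sub_sq_real, norm_sub_sq_real, norm_imaginaryUnit hJ, norm_imaginaryUnit hLu] at h2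
    linarith
  exact hne (by rw [hJK, hKb, add_neg_cancel])

end Sphere
-- Local constancy on the slice through the minimum point.
section MinimumPrinciple

variable {A : Type} [NormedStarAlternative A] [Nontrivial A]

variable {D : Set ℂ} {F₁ F₂ : ℂ → A} {f : A → A} {z : ℂ} {J : A}

theorem stemNorm_ne_zero_of_isLocalMinOn
    (hA : ∃ I₁ ∈ imaginaryUnits A, ∃ I₂ ∈ imaginaryUnits A, I₁ * star I₂ + I₂ * star I₁ = 0)
    (hf : Induces D F₁ F₂ f) (hz : z ∈ D) (hJ : J ∈ imaginaryUnits A)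
    (hmin : IsLocalMinOn (fun x => ‖f x‖) (circularization A D) (slicePoint J z))
    (hne : f (slicePoint J z) ≠ 0) : stemNorm (F₁ z) (F₂ z) ≠ 0 := by
  rw [hf z hz J hJ] at hne
  refine stemNorm_ne_zero_of_isLocalMinOn_units hA hJ hne ?_
  have ht : Filter.Tendsto (fun L : A => slicePoint L z) (𝓝[imaginaryUnits A] J)
      (𝓝[circularization A D] (slicePoint J z)) := by
    refine tendsto_nhdsWithin_iff.2 ⟨?_, ?_⟩
    · have hc : Continuous fun L : A => slicePoint L z :=
        continuous_slicePoint.comp (by fun_prop : Continuous fun L : A => (L, z))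
      exact (hc.tendsto J).mono_left nhdsWithin_le_nhds
    · filter_upwards [self_mem_nhdsWithin] with L hL
      exact slicePoint_mem_circularization hz hL
  filter_upwards [ht.eventually hmin, self_mem_nhdsWithin] with L h1 hL
  rwa [hf z hz J hJ, hf z hz L hL] at h1

theorem slice_eventuallyEq_of_stemNorm_ne_zero (hD : IsOpen D)
    (hF : ∀ w ∈ D, HolomorphicStemAt F₁ F₂ w)
    (hassoc : ∀ w ∈ D, ∀ K ∈ imaginaryUnits A, associator K (F₁ w) (F₂ w) = 0)
    (hf : Induces D F₁ F₂ f) (hz : z ∈ D) (hJ : J ∈ imaginaryUnits A)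
    (hmin : IsLocalMinOn (fun x => ‖f x‖) (circularization A D) (slicePoint J z))
    (hne : f (slicePoint J z) ≠ 0) (hN : stemNorm (F₁ z) (F₂ z) ≠ 0) :
    ∀ᶠ w in 𝓝 z, F₁ w + J * F₂ w = F₁ z + J * F₂ z := by
  have hDz : ∀ᶠ w in 𝓝 z, w ∈ D := hD.mem_nhds hz
  rw [hf z hz J hJ] at hne
  set f₀ : A := F₁ z + J * F₂ z with hf₀
  set J' : A := conjUnit J f₀ with hJ'def
  have hJ' : J' ∈ imaginaryUnits A := conjUnit_mem hJ hne
  set p : ℂ → A := fun w => star (F₁ w) + J' * star (F₂ w) with hp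
  set N : ℂ → ℂ := fun w => stemNorm (F₁ w) (F₂ w) with hNdef
  have hfp : f₀ * p z = slicePoint J (N z) := mul_conj_slice hJ hne (hassoc z hz J hJ)
  have hfp' : ‖f₀‖ * ‖p z‖ = ‖N z‖ := by rw [← norm_mul', hfp, norm_slicePoint hJ]
  have hpz : p z ≠ 0 := by
    intro h
    rw [h, norm_zero, mul_zero] at hfp'
    exact hN (norm_eq_zero.1 hfp'.symm)
  have hpc : ContinuousAt p z := by
    have h1 := (hF z hz).fst.continuousAt
    have h2 := (hF z hz).snd.continuousAt
    fun_prop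
  have hp0 : ∀ᶠ w in 𝓝 z, p w ≠ 0 := hpc.eventually_ne hpz
  set q : ℂ → A := fun w => conjUnit J' (p w) with hq
  have hqz : q z = J := conjUnit_conjUnit hJ hne hpz hfp
  have hqc : ContinuousAt q z := by
    have hpz' : ‖p z‖ ^ 2 ≠ 0 := pow_ne_zero _ (norm_ne_zero_iff.2 hpz)
    exact ((hpc.norm.pow 2).inv₀ hpz').smul (hpc.star.mul (continuousAt_const.mul hpc))
  have hpq : ∀ w ∈ D, p w ≠ 0 → p w * (F₁ w + q w * F₂ w) = slicePoint J' (N w) := by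
    intro w hw hw0
    have h := mul_conj_slice (a := star (F₁ w)) (b := star (F₂ w)) hJ' hw0
      (by rw [associator_star_middle, associator_star_right, hassoc w hw J' hJ', neg_zero,
        neg_zero])
    rwa [star_star, star_star, stemNorm_star] at h
  -- The comparison points change slice with `w`, so minimality in the whole of `Ω` is needed, not
  -- only in the slice of `J`.
  have ht : Filter.Tendsto (fun w => slicePoint (q w) w) (𝓝 z)
      (𝓝[circularization A D] (slicePoint J z)) := by
    refine tendsto_nhdsWithin_iff.2 ⟨?_, ?_⟩
    · have h := (continuous_slicePoint (A := A)).continuousAt.comp (hqc.prodMk continuousAt_id)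
      have h' : Filter.Tendsto (fun w => slicePoint (q w) w) (𝓝 z) (𝓝 (slicePoint (q z) z)) := h
      rwa [hqz] at h'
    · filter_upwards [hDz, hp0] with w hw hw0
      exact slicePoint_mem_circularization hw (conjUnit_mem hJ' hw0)
  have hmax : ∀ᶠ w in 𝓝 z, ‖p w‖ * ‖N z‖ ≤ ‖p z‖ * ‖N w‖ := by
    filter_upwards [ht.eventually hmin, hDz, hp0] with w h1 hw hw0
    rw [hf z hz J hJ, hf w hw _ (conjUnit_mem hJ' hw0), ← hf₀] at h1
    have h2 : ‖p w‖ * ‖F₁ w + q w * F₂ w‖ = ‖N w‖ := by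
      rw [← norm_mul', hpq w hw hw0, norm_slicePoint hJ']
    rw [← h2, ← hfp']
    nlinarith [mul_le_mul_of_nonneg_left h1 (mul_nonneg (norm_nonneg (p w)) (norm_nonneg (p z)))]
  have hNd : ∀ᶠ w in 𝓝 z, DifferentiableAt ℂ N w :=
    hDz.mono fun w hw => (hF w hw).differentiableAt_stemNorm
  have hconst := eventually_eq_slicePoint_mul_of_isLocalMax
    (hDz.mono fun w hw => (hF w hw).conj_stem) hNd hN hJ' hmax
  set c : A := slicePoint J' (N z)⁻¹ * p z with hc
  have hc0 : c ≠ 0 := by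
    rw [← norm_ne_zero_iff, hc, norm_mul', norm_slicePoint hJ']
    exact mul_ne_zero (norm_ne_zero_iff.2 (inv_ne_zero hN)) (norm_ne_zero_iff.2 hpz)
  -- `c` and `p z` differ by a factor in `ℂ_J'`, so both conjugate `J'` to `q z = J`.
  have hJc : conjUnit J' c = J := by
    rw [hc, conjUnit_slicePoint_mul hJ' (inv_ne_zero hN)]
    exact hqz
  have hfin : ∀ᶠ w in 𝓝 z, F₁ w + J * F₂ w = (‖c‖ ^ 2)⁻¹ • star c := by
    filter_upwards [hconst, hDz, hp0, hNd.self_of_nhds.continuousAt.eventually_ne hN]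
      with w h1 hw hw0 hNw
    have h2 := hpq w hw hw0
    have h3 : p w = slicePoint J' (N w) * c := h1
    have h4 : q w = J := by
      rw [hq]
      change conjUnit J' (p w) = J
      rw [h3, conjUnit_slicePoint_mul hJ' hNw, hJc]
    rw [h4, h3] at h2
    exact eq_of_slicePoint_mul_mul_eq hJ' hNw hc0 h2
  filter_upwards [hfin] with w hw
  rw [hw, hf₀, hfin.self_of_nhds]

/-- When `A = ℂ_J`, pairing with `1` is an isometric identification with `ℂ`, and the classical
minimum modulus principle applies. -/
theorem slice_eventuallyEq_of_forall_eq_slicePoint (hD : IsOpen D)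
    (hF : ∀ w ∈ D, HolomorphicStemAt F₁ F₂ w)
    (hf : Induces D F₁ F₂ f) (hz : z ∈ D) (hJ : J ∈ imaginaryUnits A)
    (hdim : ∀ a : A, ∃ ν : ℂ, a = slicePoint J ν)
    (hmin : IsLocalMinOn (fun x => ‖f x‖) (circularization A D) (slicePoint J z))
    (hne : f (slicePoint J z) ≠ 0) :
    ∀ᶠ w in 𝓝 z, F₁ w + J * F₂ w = F₁ z + J * F₂ z := by
  have hDz : ∀ᶠ w in 𝓝 z, w ∈ D := hD.mem_nhds hz
  rw [hf z hz J hJ] at hne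
  have hpair : ∀ ν : ℂ, pairing J 1 (slicePoint J ν) = ν := by
    intro ν
    have h := pairing_slicePoint_mul hJ 1 1 ν
    rw [mul_one, pairing_self hJ, norm_one'] at h
    simpa using h
  have hnorm : ∀ a : A, ‖pairing J 1 a‖ = ‖a‖ := by
    intro a
    obtain ⟨ν, rfl⟩ := hdim a
    rw [hpair, norm_slicePoint hJ]
  have hinj : ∀ a b : A, pairing J 1 a = pairing J 1 b → a = b := by
    intro a b h
    rw [← sub_eq_zero, ← norm_eq_zero, ← hnorm, map_sub, h, sub_self, norm_zero]
  have ht : Filter.Tendsto (fun w => slicePoint J w) (𝓝 z)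
      (𝓝[circularization A D] (slicePoint J z)) := by
    refine tendsto_nhdsWithin_iff.2 ⟨?_, hDz.mono fun w hw => slicePoint_mem_circularization hw hJ⟩
    have hc : Continuous fun w : ℂ => slicePoint J w :=
      continuous_slicePoint.comp (by fun_prop : Continuous fun w : ℂ => (J, w))
    exact hc.tendsto z
  have hloc : IsLocalMin (norm ∘ fun w => pairing J 1 (F₁ w + J * F₂ w)) z := by
    filter_upwards [ht.eventually hmin, hDz] with w h1 hw
    rw [hf z hz J hJ, hf w hw J hJ] at h1
    simpa only [Function.comp_apply, hnorm] using h1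
  rcases Complex.eventually_eq_or_eq_zero_of_isLocalMin_norm
    (hDz.mono fun w hw => (hF w hw).differentiableAt_pairing hJ 1) hloc with h | h
  · exact h.mono fun w hw => hinj _ _ hw
  · exact absurd (by rw [← norm_eq_zero, ← hnorm, h, norm_zero]) hne

end MinimumPrinciple

/-! ### From local constancy to slice domains and product domains. -/

section Domains

variable {A : Type} [NormedStarAlternative A] [Nontrivial A]
variable {D : Set ℂ} {F₁ F₂ : ℂ → A} {f : A → A} {z : ℂ} {J : A}

/-- Comparing `w` with its conjugate gives `F₁ + J F₂ = F₁ - J F₂`. -/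
theorem isStem_eq_of_slice_eq (hDc : ∀ w ∈ D, conj w ∈ D) (hS : IsStem D F₁ F₂)
    (hJ : J ∈ imaginaryUnits A) {c : A} (h : ∀ w ∈ D, F₁ w + J * F₂ w = c) :
    ∀ w ∈ D, F₁ w = c ∧ F₂ w = 0 := by
  intro w hw
  have h1 := h w hw
  have h2 := h (conj w) (hDc w hw)
  rw [hS.even w hw, hS.odd w hw, mul_neg] at h2
  have h3 : (2 : ℝ) • (J * F₂ w) = 0 := by
    rw [← sub_self c]; nth_rewrite 1 [← h1]; rw [← h2]; module
  have h4 : J * F₂ w = 0 := (smul_eq_zero.1 h3).resolve_left two_ne_zero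
  refine ⟨by rw [← h1, h4, add_zero], ?_⟩
  rw [← norm_eq_zero, ← one_mul ‖F₂ w‖, ← norm_imaginaryUnit hJ, ← norm_mul', h4, norm_zero]

theorem im_pos_of_isPreconnected {C : Set ℂ} (hC : IsPreconnected C)
    (hR : ∀ r : ℝ, (r : ℂ) ∉ C) {z w : ℂ} (hz : z ∈ C) (hw : w ∈ C) (h : 0 < z.im) : 0 < w.im := by
  by_contra! hle
  have hi := hC.intermediate_value hw hz Complex.continuous_im.continuousOn
  obtain ⟨u, hu, hu0⟩ := hi ⟨hle, h.le⟩
  refine hR u.re ?_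
  rwa [show ((u.re : ℝ) : ℂ) = u from Complex.ext (by simp) (by simp [hu0])]

/-- A component avoids `ℝ`, so it lies in one half-plane; conjugation puts the other component in
the opposite one. -/
theorem mem_connectedComponentIn_of_isProductDomain (h : IsProductDomain D)
    {z w : ℂ} (hz : z ∈ D) (hw : w ∈ D) (hs : 0 < z.im * w.im) :
    w ∈ connectedComponentIn D z := by
  obtain ⟨-, hR, a, ha, b, hb, -, hab, hconj⟩ := h
  have hRsub : ∀ c, ∀ r : ℝ, (r : ℂ) ∉ connectedComponentIn D c := fun c r hr =>
    hR r (connectedComponentIn_subset _ _ hr)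
  have hsgn : ∀ c, ∀ u ∈ connectedComponentIn D c, ∀ v ∈ connectedComponentIn D c,
      0 < u.im * v.im := by
    intro c u hu v hv
    have hne : ∀ x ∈ connectedComponentIn D c, x.im ≠ 0 := by
      intro x hx h0
      refine hRsub c x.re ?_
      rwa [show ((x.re : ℝ) : ℂ) = x from Complex.ext (by simp) (by simp [h0])]
    have hpc := isPreconnected_connectedComponentIn (x := c) (F := D)
    rcases lt_or_gt_of_ne (hne u hu) with h1 | h1 <;> rcases lt_or_gt_of_ne (hne v hv) with h2 | h2
    · exact mul_pos_of_neg_of_neg h1 h2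
    · exact absurd (im_pos_of_isPreconnected hpc (hRsub c) hv hu h2) h1.not_gt
    · exact absurd (im_pos_of_isPreconnected hpc (hRsub c) hu hv h1) h2.not_gt
    · exact mul_pos h1 h2
  have hcross : ∀ u ∈ connectedComponentIn D a, ∀ v ∈ connectedComponentIn D b,
      u.im * v.im < 0 := by
    intro u hu v hv
    rw [← hconj] at hv
    obtain ⟨v', hv', rfl⟩ := hv
    have := hsgn a u hu v' hv'
    rw [Complex.conj_im]; linarith
  rw [hab] at hz hw
  rcases hz with hz | hz <;> rcases hw with hw | hw
  · rwa [← connectedComponentIn_eq hz]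
  · exact absurd (hcross z hz w hw) hs.not_gt
  · exact absurd (hcross w hw z hz) (by rw [mul_comm]; exact hs.not_gt)
  · rwa [← connectedComponentIn_eq hz]

theorem mem_of_slicePoint_mem_circularization (hDc : ∀ w ∈ D, conj w ∈ D)
    (hJ : J ∈ imaginaryUnits A) {w : ℂ} (h : slicePoint J w ∈ circularization A D) : w ∈ D := by
  obtain ⟨u, hu, K, hK, h⟩ := h
  have hre : w.re = u.re := by
    have h1 := congrArg (inner ℝ (1 : A)) h
    simp only [slicePoint, inner_add_right, inner_smul_right, inner_one_unit hJ,
      inner_one_unit hK, real_inner_self_eq_norm_sq, norm_one'] at h1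
    simpa using h1
  have him : |w.im| = |u.im| := by
    rw [slicePoint, slicePoint, hre] at h
    have h1 := congrArg norm (add_left_cancel h)
    rwa [norm_smul, norm_smul, norm_imaginaryUnit hJ, norm_imaginaryUnit hK, mul_one, mul_one] at h1
  rcases abs_eq_abs.1 him with h1 | h1
  · rwa [Complex.ext hre h1]
  · rw [show w = conj u from Complex.ext (by simpa using hre) (by simpa using h1)]
    exact hDc u hu

theorem neg_mem_imaginaryUnits (hJ : J ∈ imaginaryUnits A) : -J ∈ imaginaryUnits A := by
  rw [mem_imaginaryUnits_iff] at hJ ⊢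
  rw [star_neg, hJ.1, norm_neg]
  exact ⟨rfl, hJ.2⟩

/-- At `x = α + βK`, real parts drop out of associators and `β` cancels against the `β⁻¹` in `f'_s`.
At real points `F₂ = 0` by oddness. -/
theorem associator_stem_eq_zero (hDc : ∀ w ∈ D, conj w ∈ D) (hS : IsStem D F₁ F₂)
    (hf : Induces D F₁ F₂ f)
    (hassoc : ∀ x ∈ circularization A D \ realLine A,
      associator x (sliceConj f x) (sphericalDerivative f x) = 0)
    {w : ℂ} (hw : w ∈ D) {K : A} (hK : K ∈ imaginaryUnits A) :
    associator K (F₁ w) (F₂ w) = 0 := by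
  by_cases h0 : w.im = 0
  · have h := hS.odd w hw
    rw [Complex.conj_eq_iff_im.2 h0, eq_neg_iff_add_eq_zero, ← two_smul ℝ] at h
    rw [(smul_eq_zero.1 h).resolve_left two_ne_zero, associator, mul_zero, mul_zero, mul_zero,
      sub_zero]
  · have hx : slicePoint K w ∉ realLine A := by
      rintro ⟨r, hr⟩
      have h1 := congrArg (inner ℝ K) hr
      have h2 : inner ℝ K (1 : A) = (0 : ℝ) := by rw [real_inner_comm, inner_one_unit hK]
      simp only [slicePoint, inner_add_right, inner_smul_right, h2, real_inner_self_eq_norm_sq,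
        norm_imaginaryUnit hK] at h1
      exact h0 (by simpa using h1)
    have h := hassoc _ ⟨slicePoint_mem_circularization hw hK, hx⟩
    rw [sphericalDerivative_slicePoint hDc hS hf hw h0 hK,
      induces_sliceConj hDc hS hf w hw K hK] at h
    have h1 := associator_star_right K (K * star (F₂ w)) (star (F₂ w))
    rw [star_star, associator_mul_self_right, neg_zero] at h1
    have h2 : ∀ (y u : A) (r : ℝ),
        associator (slicePoint K w) y (r • u) = (r * w.im) • associator K y u := by
      intro y u r
      simp only [associator, slicePoint, add_mul, smul_mul', mul_smul', one_mul]
      module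
    have h3 : associator K (star (F₁ w) + K * star (F₂ w)) (F₂ w) =
        associator K (star (F₁ w)) (F₂ w) + associator K (K * star (F₂ w)) (F₂ w) := by
      simp only [associator, add_mul, mul_add]
      abel
    rw [h2, inv_mul_cancel₀ h0, one_smul, h3, h1, add_zero, associator_star_middle,
      neg_eq_zero] at h
    exact h

theorem minimum_modulus_of_slice_eventuallyEq (hD : IsOpen D) (hDc : ∀ w ∈ D, conj w ∈ D)
    (hS : IsStem D F₁ F₂) (hf : Induces D F₁ F₂ f)
    (hF : ∀ w ∈ D, HolomorphicStemAt F₁ F₂ w) (hz : z ∈ D) (hJ : J ∈ imaginaryUnits A)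
    (h : ∀ᶠ w in 𝓝 z, F₁ w + J * F₂ w = F₁ z + J * F₂ z) :
    (IsSliceDomain D → ∃ c, ∀ x ∈ circularization A D, f x = c) ∧
    (IsProductDomain D → ∃ K ∈ imaginaryUnits A,
      ∀ x ∈ circularization A D ∩ halfSlice K, f x = f (slicePoint J z)) := by
  constructor
  · intro hs
    have h1 := isStem_eq_of_slice_eq hDc hS hJ
      (slice_eqOn_of_eventuallyEq hD hs.2.1.isPreconnected hF hJ hz h)
    refine ⟨F₁ z + J * F₂ z, ?_⟩
    rintro x ⟨w, hw, K, hK, rfl⟩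
    rw [hf w hw K hK, (h1 w hw).1, (h1 w hw).2, mul_zero, add_zero]
  · intro hp
    have h1 := slice_eqOn_of_eventuallyEq hD.connectedComponentIn
      isPreconnected_connectedComponentIn
      (fun w hw => hF w (connectedComponentIn_subset D z hw)) hJ (mem_connectedComponentIn hz) h
    have h2 : ∀ w ∈ D, 0 < z.im * w.im → f (slicePoint J w) = f (slicePoint J z) := by
      intro w hw hs
      rw [hf w hw J hJ, hf z hz J hJ]
      exact h1 w (mem_connectedComponentIn_of_isProductDomain hp hz hw hs)
    have hz0 : z.im ≠ 0 := by
      intro h0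
      refine hp.2.1 z.re ?_
      rwa [show ((z.re : ℝ) : ℂ) = z from Complex.ext (by simp) (by simp [h0])]
    rcases lt_or_gt_of_ne hz0 with hlt | hgt
    -- If `z` lies in the lower half-plane, the half-slice containing `x₀` is that of `-J`.
    · refine ⟨-J, neg_mem_imaginaryUnits hJ, ?_⟩
      rintro x ⟨hx, w, hw, rfl⟩
      have hwD := mem_of_slicePoint_mem_circularization hDc (neg_mem_imaginaryUnits hJ) hx
      rw [slicePoint_neg]
      exact h2 _ (hDc w hwD) (by rw [Complex.conj_im]; exact mul_pos_of_neg_of_neg hlt (by linarith))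
    · refine ⟨J, hJ, ?_⟩
      rintro x ⟨hx, w, hw, rfl⟩
      exact h2 w (mem_of_slicePoint_mem_circularization hDc hJ hx) (mul_pos hgt hw)

end Domains

theorem IsSliceRegular.exists_holomorphicStem {A : Type} [NormedStarAlternative A] {D : Set ℂ}
    (hD : IsOpen D) {f : A → A} (hf : IsSliceRegular D f) :
    ∃ F₁ F₂ : ℂ → A, IsStem D F₁ F₂ ∧ Induces D F₁ F₂ f ∧
      ∀ w ∈ D, HolomorphicStemAt F₁ F₂ w := by
  obtain ⟨F₁, F₂, hS, hI, h1, h2, hCR⟩ := hf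
  refine ⟨F₁, F₂, hS, hI, fun w hw => ⟨?_, ?_, (hCR w hw).1, (hCR w hw).2⟩⟩
  · exact (h1.differentiableOn one_ne_zero).differentiableAt (hD.mem_nhds hw)
  · exact (h2.differentiableOn one_ne_zero).differentiableAt (hD.mem_nhds hw)

/-! ### The three algebras: orthogonal units in `ℍ` and `𝕆`, the single slice of `ℂ`. -/

instance (k : HypercomplexKind) : Nontrivial k.Carrier := by
  cases k
  · exact inferInstanceAs (Nontrivial ℂ)
  · exact inferInstanceAs (Nontrivial ℍ[ℝ])
  · exact ⟨(Octonion.mk 1 0 : Octonion), (Octonion.mk 0 0 : Octonion),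
      fun h => one_ne_zero (congrArg Octonion.fst h)⟩

theorem exists_orthogonal_units_quaternion :
    ∃ I₁ ∈ imaginaryUnits ℍ[ℝ], ∃ I₂ ∈ imaginaryUnits ℍ[ℝ], I₁ * star I₂ + I₂ * star I₁ = 0 := by
  obtain ⟨i, hi⟩ : ∃ i : ℍ[ℝ], i.re = 0 ∧ i.imI = 1 ∧ i.imJ = 0 ∧ i.imK = 0 :=
    ⟨⟨0, 1, 0, 0⟩, rfl, rfl, rfl, rfl⟩
  obtain ⟨j, hj⟩ : ∃ j : ℍ[ℝ], j.re = 0 ∧ j.imI = 0 ∧ j.imJ = 1 ∧ j.imK = 0 :=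
    ⟨⟨0, 0, 1, 0⟩, rfl, rfl, rfl, rfl⟩
  have hi' : i + star i = 0 ∧ i * star i = 1 := by constructor <;> ext <;> simp [hi]
  have hj' : j + star j = 0 ∧ j * star j = 1 := by constructor <;> ext <;> simp [hj]
  have hij : i * star j + j * star i = 0 := by ext <;> simp [hi, hj]
  exact ⟨i, hi', j, hj', hij⟩

theorem octonion_mk_mul_star (a b : ℍ[ℝ]) :
    Octonion.mk a 0 * star (Octonion.mk b 0) = Octonion.mk (a * star b) 0 := by
  apply Octonion.ext
  · rw [Octonion.fst_mul, Octonion.fst_star, Octonion.snd_star]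
    simp
  · simp

theorem exists_orthogonal_units_octonion :
    ∃ I₁ ∈ imaginaryUnits Octonion, ∃ I₂ ∈ imaginaryUnits Octonion,
      I₁ * star I₂ + I₂ * star I₁ = 0 := by
  obtain ⟨a, ha, b, hb, hab⟩ := exists_orthogonal_units_quaternion
  have hu : ∀ c ∈ imaginaryUnits ℍ[ℝ], Octonion.mk c 0 ∈ imaginaryUnits Octonion := fun c hc =>
    ⟨Octonion.ext hc.1 (by simp), 
      (octonion_mk_mul_star c c).trans (congrArg (Octonion.mk · 0) hc.2)⟩
  exact ⟨_, hu a ha, _, hu b hb, Octonion.ext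
    ((congrArg Octonion.fst (congrArg₂ (· + ·) (octonion_mk_mul_star a b)
      (octonion_mk_mul_star b a))).trans hab) (by simp)⟩

theorem exists_eq_slicePoint_complex {J : ℂ} (hJ : J ∈ imaginaryUnits ℂ) (a : ℂ) :
    ∃ ν : ℂ, a = slicePoint J ν := by
  have h1 : J.re = 0 := by
    have h : J.re + J.re = 0 := congrArg Complex.re hJ.1
    linarith
  have h2 : J.im * J.im = 1 := by
    have h : J.re * J.re - J.im * -J.im = 1 := congrArg Complex.re hJ.2
    rw [h1] at h
    linarith
  refine ⟨⟨a.re, a.im * J.im⟩, ?_⟩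
  have h3 : a = a.re • (1 : ℂ) + (a.im * J.im) • J := by
    apply Complex.ext <;> simp [h1, mul_assoc, h2]
  exact h3

end StarAlternative

open StarAlternative

theorem mainTheorem12 (k : HypercomplexKind) (D : Set ℂ) (hD : IsOpen D)
    (hDconj : ∀ z ∈ D, (starRingEnd ℂ) z ∈ D)
    (f : k.Carrier → k.Carrier) (hf : IsSliceRegular D f)
    (hassoc : ∀ x ∈ circularization k.Carrier D \ realLine k.Carrier,
      associator x (sliceConj f x) (sphericalDerivative f x) = 0)
    (x₀ : k.Carrier) (hx₀ : x₀ ∈ circularization k.Carrier D)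
    (hmin : IsLocalMinOn (fun x => ‖f x‖) (circularization k.Carrier D) x₀)
    (hne : f x₀ ≠ 0) :
    (IsSliceDomain D → ∃ c, ∀ x ∈ circularization k.Carrier D, f x = c) ∧
    (IsProductDomain D → ∃ J ∈ imaginaryUnits k.Carrier,
      ∀ x ∈ circularization k.Carrier D ∩ halfSlice J, f x = f x₀) := by
  obtain ⟨F₁, F₂, hS, hI, hF⟩ := IsSliceRegular.exists_holomorphicStem hD hf
  obtain ⟨z, hz, J, hJ, rfl⟩ := hx₀
  refine minimum_modulus_of_slice_eventuallyEq hD hDconj hS hI hF hz hJ ?_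
  -- Either the sphere of units has positive dimension, or the algebra is a single slice.
  have hunits : (∃ I₁ ∈ imaginaryUnits k.Carrier, ∃ I₂ ∈ imaginaryUnits k.Carrier,
      I₁ * star I₂ + I₂ * star I₁ = 0) ∨ ∀ a : k.Carrier, ∃ ν : ℂ, a = slicePoint J ν := by
    cases k
    · exact Or.inr (exists_eq_slicePoint_complex hJ)
    · exact Or.inl exists_orthogonal_units_quaternion
    · exact Or.inl exists_orthogonal_units_octonion
  rcases hunits with hA | hdim
  · exact slice_eventuallyEq_of_stemNorm_ne_zero hD hF
      (fun w hw K hK => associator_stem_eq_zero hDconj hS hI hassoc hw hK) hI hz hJ hmin hne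
      (stemNorm_ne_zero_of_isLocalMinOn hA hI hz hJ hmin hne)
  · exact slice_eventuallyEq_of_forall_eq_slicePoint hD hF hI hz hJ hdim hmin hne
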